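/- **Setting.** Let $(S_1,\mathcal S_1),\dots,(S_K,\mathcal S_K)$ be measurable spaces, $S=S_1\times\dots\times S_K$ with the product $\sigma$-algebra, and $[K]=\{1,\dots,K\}$. Let $\theta_1,\dots,\theta_I>0$ with $\sum_{i=1}^I\theta_i=1$ and $\mu=\sum_{i=1}^I\theta_i\mu^i$, where, for each $i$, $\{\mathcal K^i_1,\dots,\mathcal K^i_{K_i}\}$ is a partition of $[K]$ and $\mu^i=\prod_{k=1}^{K_i}\mu^i_k$ is the product of probability distributions $\mu^i_k$ on $S^i_k=\prod_{k'\in\mathcal K^i_k}S_{k'}$. For each $i$ let $X^{i,1},X^{i,2},\dots$ be i.i.d. samples from $\mu^i$, the $I$ sequences being independent of each other. Write $X^{i,n}=(X^{i,n}_1,\dots,X^{i,n}_{K_i})$ with $X^{i,n}_k\in S^i_k$, and $X^{i,\boldsymbol n}=(X^{i,n_1}_1,\dots,X^{i,n_{K_i}}_{K_i})$ for $\boldsymbol n\in\{1,2,\dots\}^{K_i}$. For measurable $\varphi:S\to\mathbb R$ and integers $N_1,\dots,N_I\ge1$ put $$\mu^{i,N_i}(\varphi)=\frac1{N_i}\sum_{n=1}^{N_i}\varphi(X^{i,n}),\qquad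 \mu^{i,N_i}_\times(\varphi)=\frac1{N_i^{K_i}}\sum_{\boldsymbol n\in[N_i]^{K_i}}\varphi(X^{i,\boldsymbol n}),$$ $$\mu^N_s(\varphi)=\sum_{i=1}^I\theta_i\mu^{i,N_i}(\varphi),\qquad \mu^N_{s,\times}(\varphi)=\sum_{i=1}^I\theta_i\mu^{i,N_i}_\times(\varphi).$$ For $A\subseteq[K_i]$ let $\mu^i_A=\prod_{k\in A}\mu^i_k$, let $\mu^i_A(\psi)$ be the function obtained from $\psi$ by integrating its arguments indexed by $A$ against $\mu^i_A$ ($\mu^i_\emptyset(\psi)=\psi$), and let $A^c=[K_i]\setminus A$. For $B\subseteq A\subseteq[K_i]$ and $\psi\in L^2_{\mu^i_A}$ put $$[\sigma^i_{A,B}(\psi)]^2=\mu^i_A\big([\mu^i_{A\setminus B}(\psi)-\mu^i_A(\psi)]^2\big),\qquad [\sigma^i_\times(\varphi)]^2=\sum_{k=1}^{K_i}\mu^i_k\big([\mu^i_{[K_i]\setminus\{k\}}(\varphi)-\mu^i(\varphi)]^2\big).$$ **Claim 1.** If $\varphi$ is $\mu$-integrable, then for all integers $N_1,\dots,N_I\ge1$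 the estimator $\mu^N_{s,\times}(\varphi)$ is integrable and unbiased: $\mathbb E[\mu^N_{s,\times}(\varphi)]=\mu(\varphi)$. **Claim 2.** Let $\varphi\in L^2_\mu$. Then, for all $i$ and $A\subseteq[K_i]$, the integral defining $\mu^i_{A}(\varphi)$ converges almost everywhere and $\mu^i_A(\varphi)\in L^2_{\mu^i_{A^c}}$. Let $\alpha_1,\dots,\alpha_I>0$, and let $N$ range over the reals $N>0$ such that $N_i:=\alpha_iN$ is an integer for every $i$. Then: * (strong consistency) $\mu^N_{s,\times}(\varphi)\to\mu(\varphi)$ almost surely as $N\to\infty$; * (asymptotic normality) $N^{1/2}[\mu^N_{s,\times}(\varphi)-\mu(\varphi)]\Rightarrow\mathcal N(0,\sigma^2_{s,\times}(\varphi))$ as $N\to\infty$, where $\sigma^2_{s,\times}(\varphi)=\sum_{i=1}^I[\theta_i\sigma^i_\times(\varphi)]^2/\alpha_i$; * (variance) for every such $N$, the $\mu^{i,N_i}_\times(\varphi)$ and $\mu^N_{s,\times}(\varphi)$ are square integrable and $$\mathrm{Var}(\mu^N_{s,\times}(\varphi))=\sum_{i=1}^I\theta_i^2\,\mathrm{Var}(\mu^{i,N_i}_\times(\varphi))=\sum_{i=1}^I\theta_i^2\sum_{\emptyset\ne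 A\subseteq[K_i]}\frac{\sum_{B\subseteq A}(-1)^{|A|-|B|}[\sigma^i_{A,B}(\mu^i_{A^c}(\varphi))]^2}{\alpha_i^{|A|}N^{|A|}}.$$ **Claim 3.** Let $\varphi\in L^2_\mu$ and $\alpha_i=\theta_i$ for all $i$. Then, for every such $N$, the $\mu^{i,N_i}(\varphi)$ and $\mu^N_s(\varphi)$ are square integrable, $$\mathrm{Var}(\mu^N_{s,\times}(\varphi))=\sum_{i=1}^I\theta_i^2\,\mathrm{Var}(\mu^{i,N_i}_\times(\varphi))\le\sum_{i=1}^I\theta_i^2\,\mathrm{Var}(\mu^{i,N_i}(\varphi))=\mathrm{Var}(\mu^N_s(\varphi)),$$ and $$\sigma^2_{s,\times}(\varphi)=\sum_{i=1}^I\theta_i[\sigma^i_\times(\varphi)]^2\le\sum_{i=1}^I\theta_i\,\mu^i([\varphi-\mu^i(\varphi)]^2)=\lim_{N\to\infty}N\,\mathrm{Var}(\mu^N_s(\varphi)).$$ -/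

import Mathlib

open MeasureTheory ProbabilityTheory Filter Topology

noncomputable section

namespace MixProd

/-! ### Partial integrals and variance components of a product of finitely many laws -/

section Product

variable {J : Type*} [Fintype J] [DecidableEq J] {T : J → Type*} [∀ j, MeasurableSpace (T j)]

/-- The product law `μ_A = ∏_{j ∈ A} μ_j`. -/
def subLaw (μ : ∀ j, Measure (T j)) (A : Finset J) : Measure (∀ j : A, T j) :=
  Measure.pi (fun j : A => μ j)

/-- `μ_A(ψ)`: integrate out the arguments of `ψ` indexed by `A` against `μ_A`. The result is regarded
as a function on the whole product that does not depend on the coordinates in `A` (same convention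
as for Mathlib's `lmarginal`). For `A = ∅` this is `ψ`. -/
def partialInt (μ : ∀ j, Measure (T j)) (A : Finset J) (ψ : (∀ j, T j) → ℝ) :
    (∀ j, T j) → ℝ :=
  fun x => ∫ y, ψ (Function.updateFinset x A y) ∂(subLaw μ A)

/-- `σ²_{A,B}(ψ) = μ_A([μ_{A∖B}(ψ) - μ_A(ψ)]²)`, for `ψ` a function of the coordinates in `A`.
The squared function depends on the coordinates in `A` only, so that its integral against the
probability `μ_A` is its integral against the full product law. -/
def sigmaSq (μ : ∀ j, Measure (T j)) (A B : Finset J) (ψ : (∀ j, T j) → ℝ) : ℝ :=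
  ∫ x, (partialInt μ (A \ B) ψ x - partialInt μ A ψ x) ^ 2 ∂(Measure.pi μ)

/-- `σ²_×(ψ) = ∑_k μ_k([μ_{{k}ᶜ}(ψ) - μ(ψ)]²)`; again the `k`-th squared function depends on the
coordinate `k` only, and is integrated against the full product law. -/
def sigmaProdSq (μ : ∀ j, Measure (T j)) (ψ : (∀ j, T j) → ℝ) : ℝ :=
  ∑ k, ∫ x, (partialInt μ {k}ᶜ ψ x - ∫ z, ψ z ∂(Measure.pi μ)) ^ 2 ∂(Measure.pi μ)

/-- `∑_{∅ ≠ A ⊆ J} (∑_{B ⊆ A} (-1)^{|A|-|B|} σ²_{A,B}(μ_{Aᶜ}(ψ))) / (a^{|A|} N^{|A|})`. -/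
def prodVar (μ : ∀ j, Measure (T j)) (ψ : (∀ j, T j) → ℝ) (a N : ℝ) : ℝ :=
  ∑ A ∈ (Finset.univ : Finset (Finset J)).filter (fun A => A.Nonempty),
    (∑ B ∈ A.powerset, (-1 : ℝ) ^ (A.card - B.card) * sigmaSq μ A B (partialInt μ Aᶜ ψ)) /
      (a ^ A.card * N ^ A.card)

end Product

/-! ### Block factorisations of `S_1 × ⋯ × S_K` -/

section Blocks

variable {K L : ℕ} {S : Fin K → Type*}

/-- A partition of `[K]` into `L` labelled blocks is given by the (surjective) map `b` which sends
an index to the label of its block; the `j`-th block is the fibre of `b` over `j`, and this is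
the product of the `S_k` over that block. -/
abbrev BlockSpace (S : Fin K → Type*) (b : Fin K → Fin L) (j : Fin L) : Type _ :=
  ∀ k : {k : Fin K // b k = j}, S k

/-- Reassemble a point of `S_1 × ⋯ × S_K` from its blocks. -/
def glue (b : Fin K → Fin L) (x : ∀ j, BlockSpace S b j) : ∀ k, S k :=
  fun k => x (b k) ⟨k, rfl⟩

/-- The law on `S_1 × ⋯ × S_K` which is the product over the blocks of the laws `ν j`. -/
def blockLaw [∀ k, MeasurableSpace (S k)] (b : Fin K → Fin L)
    (ν : ∀ j, Measure (BlockSpace S b j)) : Measure (∀ k, S k) :=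
  (Measure.pi ν).map (glue b)

end Blocks

/-! ### Mixtures and estimators -/

section Estimators

variable {I K : ℕ} {S : Fin K → Type*} {Kb : Fin I → ℕ} {Ω : Type*}

/-- The mixture `∑ i, θ_i μ^i` of the block-product laws `μ^i`. -/
def mixture [∀ k, MeasurableSpace (S k)] (θ : Fin I → ℝ) (b : ∀ i, Fin K → Fin (Kb i))
    (ν : ∀ i j, Measure (BlockSpace S (b i) j)) : Measure (∀ k, S k) :=
  ∑ i, ENNReal.ofReal (θ i) • blockLaw (b i) (ν i)

/-- Standard estimator `(1/n) ∑_{l ≤ n} φ(X^l)` from the first `n` samples of a sequence. -/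
def stdEst (φ : (∀ k, S k) → ℝ) (X : ℕ → Ω → ∀ k, S k) (n : ℕ) (ω : Ω) : ℝ :=
  (1 / (n : ℝ)) * ∑ l : Fin n, φ (X l ω)

/-- Product-form estimator `n^{-L} ∑_{m ∈ [n]^L} φ(X^m)`, where the `j`-th block of the permuted
tuple `X^m` is the `j`-th block of the sample `X^{m_j}`. -/
def prodEst {L : ℕ} (b : Fin K → Fin L) (φ : (∀ k, S k) → ℝ) (X : ℕ → Ω → ∀ k, S k)
    (n : ℕ) (ω : Ω) : ℝ :=
  (1 / (n : ℝ) ^ L) * ∑ m : Fin L → Fin n, φ (fun k => X (m (b k)) ω k)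

/-- Stratified estimator, with `n i` samples from the `i`-th component. -/
def stratEst (θ : Fin I → ℝ) (φ : (∀ k, S k) → ℝ) (X : Fin I → ℕ → Ω → ∀ k, S k)
    (n : Fin I → ℕ) (ω : Ω) : ℝ :=
  ∑ i, θ i * stdEst φ (X i) (n i) ω

/-- Stratified product-form estimator, with `n i` samples from the `i`-th component. -/
def stratProdEst (θ : Fin I → ℝ) (b : ∀ i, Fin K → Fin (Kb i)) (φ : (∀ k, S k) → ℝ)
    (X : Fin I → ℕ → Ω → ∀ k, S k) (n : Fin I → ℕ) (ω : Ω) : ℝ :=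
  ∑ i, θ i * prodEst (b i) φ (X i) (n i) ω

/-- `σ²_{s,×}(φ) = ∑ i, [θ_i σ^i_×(φ)]² / α_i`. -/
def asympVar [∀ k, MeasurableSpace (S k)] (θ α : Fin I → ℝ) (b : ∀ i, Fin K → Fin (Kb i))
    (ν : ∀ i j, Measure (BlockSpace S (b i) j)) (φ : (∀ k, S k) → ℝ) : ℝ :=
  ∑ i, θ i ^ 2 * sigmaProdSq (ν i) (φ ∘ glue (b i)) / α i

/-- The admissible `N > 0`: those for which every `α_i N` is an integer. -/
def admissible (α : Fin I → ℝ) : Set ℝ :=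
  {N | 0 < N ∧ ∀ i, ∃ m : ℕ, (m : ℝ) = α i * N}

/-- The sample sizes `N_i = α_i N`; the floor is exact for admissible `N`. -/
def sizes (α : Fin I → ℝ) (N : ℝ) : Fin I → ℕ := fun i => ⌊α i * N⌋₊

/-- `N → ∞` along the admissible values. -/
def admTop (α : Fin I → ℝ) : Filter ℝ := atTop ⊓ 𝓟 (admissible α)

end Estimators

end MixProd

end

/-! Splitting points into blocks with `unglue` turns each product-form estimator into `vstat`, the
average of a function F over all tuples that mix coordinates of n i.i.d. samples of a product law.
Each such tuple again has the product law, which gives unbiasedness.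

The second-order theory rests on one covariance. Two tuples share the entries at the indices where
they agree and have independent entries elsewhere, so their covariance is the variance of the
projection of F onto the agreeing coordinates (`covariance_tuple`). Counting pairs by agreement set
gives `variance_vstat`: the variance is the mean of `blockVar` over a random set containing each
index independently with probability 1/n. Rewriting this in powers of 1/n by Möbius inversion
(`sum_powerset_mobius`) gives the alternating formula.

For the comparison with the standard estimator, the tuples are arranged into cyclically shifted
diagonals. A diagonal average has n uncorrelated terms and variance Var(F)/n, and `vstat` is an
average of such averages (`variance_vstat_le`). The same bound gives the strong law: variances are
summable along the squares, and for F ≥ 0 the unnormalised sums are monotone, which fills the gaps.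

For asymptotic normality, F is split into its mean, its first-order parts in single coordinates, and
a remainder. On a first-order part `vstat` is an ordinary i.i.d. average. The remainder has no
variance component of order below two, so its `vstat` has variance o(1/n)
(`tendsto_mul_variance_remainder`). The classical central limit theorem in each stratum,
independence of the strata and Slutsky's lemma conclude. Orthogonality of the first-order parts
identifies the asymptotic variance, and Bessel's inequality bounds it by Var(F). -/

set_option linter.unusedSectionVars false

noncomputable section

namespace MixProd

/-! ### Partial integrals as projections, and Möbius inversion for variance components -/

section Product

variable {J : Type*} [Fintype J] [DecidableEq J] {T : J → Type*} [∀ j, MeasurableSpace (T j)]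
  (μ : ∀ j, Measure (T j)) [∀ j, IsProbabilityMeasure (μ j)]

lemma measurePreserving_restrict (A : Finset J) :
    MeasurePreserving (fun (y : ∀ j, T j) (j : A) => y j) (Measure.pi μ) (subLaw μ A) := by
  refine ⟨by fun_prop, ?_⟩
  have h : iIndepFun (fun (j : J) (y : ∀ j, T j) => y j) (Measure.pi μ) :=
    iIndepFun_pi (X := fun _ => id) (fun _ => aemeasurable_id)
  have h' := h.precomp (g := ((↑) : A → J)) Subtype.val_injective
  rw [h'.map_fun_eq_pi_map (fun j => (measurable_pi_apply _).aemeasurable), subLaw]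
  congr 1
  ext1 j
  exact (measurePreserving_eval μ (j : J)).map_eq

instance (A : Finset J) : IsProbabilityMeasure (subLaw μ A) := by
  unfold subLaw; infer_instance

omit [Fintype J] [∀ j, MeasurableSpace (T j)] in
lemma updateFinset_restrict (A : Finset J) (x y : ∀ j, T j) :
    Function.updateFinset x A (fun j : A => y j) = A.piecewise y x := by
  ext j
  by_cases h : j ∈ A <;> simp [Function.updateFinset, h]

omit [Fintype J] in
@[fun_prop]
lemma measurable_piecewise_prod (A : Finset J) :
    Measurable (fun p : (∀ j, T j) × (∀ j, T j) => A.piecewise p.2 p.1) := by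
  rw [measurable_pi_iff]
  intro j
  by_cases h : j ∈ A <;> simp only [Finset.piecewise, h, if_true, if_false] <;> fun_prop

/-- Resampling the coordinates in `A` from an independent copy does not change the law. Using a copy
of the whole space, instead of the subproduct over `A`, lets partial integrals over different sets
be composed without changing types. -/
lemma measurePreserving_piecewise (A : Finset J) :
    MeasurePreserving (fun p : (∀ j, T j) × (∀ j, T j) => A.piecewise p.2 p.1)
      ((Measure.pi μ).prod (Measure.pi μ)) (Measure.pi μ) := by
  refine ⟨measurable_piecewise_prod A, (Measure.pi_eq fun s hs => ?_).symm⟩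
  rw [Measure.map_apply (measurable_piecewise_prod A) (.univ_pi hs)]
  have : (fun p : (∀ j, T j) × (∀ j, T j) => A.piecewise p.2 p.1) ⁻¹' Set.univ.pi s =
      (Set.univ.pi fun j => if j ∈ A then Set.univ else s j) ×ˢ
        (Set.univ.pi fun j => if j ∈ A then s j else Set.univ) := by
    ext p
    simp only [Set.mem_preimage, Set.mem_univ_pi, Set.mem_prod, ← forall_and]
    refine forall_congr' fun j => ?_
    by_cases h : j ∈ A <;> simp [h]
  rw [this, Measure.prod_prod, Measure.pi_pi, Measure.pi_pi, ← Finset.prod_mul_distrib]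
  refine Finset.prod_congr rfl fun j _ => ?_
  by_cases h : j ∈ A <;> simp [h]

lemma measurePreserving_updateFinset (A : Finset J) :
    MeasurePreserving (fun p : (∀ j, T j) × (∀ j : A, T j) => Function.updateFinset p.1 A p.2)
      ((Measure.pi μ).prod (subLaw μ A)) (Measure.pi μ) := by
  have hm : Measurable
      (fun p : (∀ j, T j) × (∀ j : A, T j) => Function.updateFinset p.1 A p.2) := by
    rw [measurable_pi_iff]
    intro j
    by_cases h : j ∈ A <;> simp only [Function.updateFinset, h, dite_true, dite_false] <;> fun_prop
  refine ⟨hm, ?_⟩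
  have h1 := (MeasurePreserving.id (Measure.pi μ)).prod (measurePreserving_restrict μ A)
  rw [← h1.map_eq, Measure.map_map hm h1.measurable]
  refine Eq.trans ?_ (measurePreserving_piecewise μ A).map_eq
  congr 1

variable {μ} {F G : (∀ j, T j) → ℝ}

lemma partialInt_eq (A : Finset J) (hF : Measurable F) (x : ∀ j, T j) :
    partialInt μ A F x = ∫ y, F (A.piecewise y x) ∂(Measure.pi μ) := by
  unfold partialInt
  rw [← (measurePreserving_restrict μ A).map_eq, integral_map]
  · simp only [updateFinset_restrict]
  · exact (measurePreserving_restrict μ A).measurable.aemeasurable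
  · exact (hF.comp (measurable_updateFinset)).aestronglyMeasurable

lemma measurable_partialInt (A : Finset J) (hF : Measurable F) : Measurable (partialInt μ A F) := by
  have h : StronglyMeasurable (fun p : (∀ j, T j) × (∀ j, T j) => F (A.piecewise p.2 p.1)) :=
    (hF.comp (measurable_piecewise_prod A)).stronglyMeasurable
  have := (h.integral_prod_right' (ν := Measure.pi μ)).measurable
  convert this using 2 with x
  exact partialInt_eq A hF x

lemma integrable_piecewise (A : Finset J) (hF : Integrable F (Measure.pi μ)) :
    Integrable (fun p : (∀ j, T j) × (∀ j, T j) => F (A.piecewise p.2 p.1))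
      ((Measure.pi μ).prod (Measure.pi μ)) :=
  (measurePreserving_piecewise μ A).integrable_comp_of_integrable hF

lemma ae_integrable_piecewise (A : Finset J) (hF : Integrable F (Measure.pi μ)) :
    ∀ᵐ x ∂(Measure.pi μ), Integrable (fun y => F (A.piecewise y x)) (Measure.pi μ) :=
  (integrable_piecewise A hF).prod_right_ae

lemma ae_integrable_updateFinset (A : Finset J) (hF : Integrable F (Measure.pi μ)) :
    ∀ᵐ x ∂(Measure.pi μ),
      Integrable (fun y => F (Function.updateFinset x A y)) (subLaw μ A) :=
  ((measurePreserving_updateFinset μ A).integrable_comp_of_integrable hF).prod_right_ae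

lemma partialInt_piecewise (A : Finset J) (x y : ∀ j, T j) :
    partialInt μ A F (A.piecewise y x) = partialInt μ A F x := by
  unfold partialInt
  congr with z
  congr 1
  ext j
  by_cases h : j ∈ A <;> simp [Function.updateFinset, h]

lemma partialInt_congr_of_eqOn (A : Finset J) {x y : ∀ j, T j} (h : ∀ j ∉ A, x j = y j) :
    partialInt μ A F x = partialInt μ A F y := by
  rw [← partialInt_piecewise A x y, ← partialInt_piecewise A y y]
  congr 1
  ext j
  by_cases hj : j ∈ A <;> simp [hj, h]

lemma integrable_partialInt (A : Finset J) (hFm : Measurable F)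
    (hF : Integrable F (Measure.pi μ)) : Integrable (partialInt μ A F) (Measure.pi μ) := by
  have := (integrable_piecewise A hF).integral_prod_left
  refine this.congr (ae_of_all _ fun x => ?_)
  exact (partialInt_eq A hFm x).symm

lemma integral_partialInt (A : Finset J) (hFm : Measurable F)
    (hF : Integrable F (Measure.pi μ)) :
    ∫ x, partialInt μ A F x ∂(Measure.pi μ) = ∫ x, F x ∂(Measure.pi μ) := by
  simp_rw [partialInt_eq A hFm]
  rw [← integral_prod _ (integrable_piecewise A hF),
    ← integral_map (measurable_piecewise_prod A).aemeasurable hFm.aestronglyMeasurable,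
    (measurePreserving_piecewise μ A).map_eq]

lemma partialInt_univ (hF : Measurable F) (x : ∀ j, T j) :
    partialInt μ Finset.univ F x = ∫ y, F y ∂(Measure.pi μ) := by
  rw [partialInt_eq _ hF]
  simp

lemma partialInt_empty (hF : Measurable F) : partialInt μ ∅ F = F := by
  ext x
  rw [partialInt_eq _ hF]
  simp

lemma partialInt_partialInt (A B : Finset J) (hFm : Measurable F)
    (hF : Integrable F (Measure.pi μ)) :
    partialInt μ A (partialInt μ B F) =ᵐ[Measure.pi μ] partialInt μ (A ∪ B) F := by
  -- Fubini on the fibre over x needs integrability there, which holds only for almost every x;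
  -- hence the almost everywhere conclusion.
  filter_upwards [ae_integrable_piecewise (A ∪ B) hF] with x hx
  rw [partialInt_eq A (measurable_partialInt B hFm), partialInt_eq _ hFm]
  -- Resampling in two stages is resampling `A ∪ B` once, from the point `B.piecewise z y`, which
  -- again has the product law.
  have key : ∀ y z : ∀ j, T j, B.piecewise z (A.piecewise y x) =
      (A ∪ B).piecewise (B.piecewise z y) x := by
    intro y z
    ext j
    by_cases h1 : j ∈ A <;> by_cases h2 : j ∈ B <;> simp [Finset.piecewise, h1, h2]
  simp_rw [partialInt_eq B hFm, key]
  have hm : Measurable fun w => F ((A ∪ B).piecewise w x) :=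
    hFm.comp ((measurable_piecewise_prod (A ∪ B)).comp measurable_prodMk_left)
  have := integral_partialInt B hm hx
  simp_rw [partialInt_eq B hm] at this
  exact this

lemma partialInt_sub (A : Finset J) (hFm : Measurable F) (hGm : Measurable G)
    (hF : Integrable F (Measure.pi μ)) (hG : Integrable G (Measure.pi μ)) :
    partialInt μ A (fun x => F x - G x) =ᵐ[Measure.pi μ]
      fun x => partialInt μ A F x - partialInt μ A G x := by
  filter_upwards [ae_integrable_piecewise A hF, ae_integrable_piecewise A hG] with x h1 h2
  rw [partialInt_eq (F := fun x => F x - G x) A (hFm.sub hGm), partialInt_eq A hFm,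
    partialInt_eq A hGm,
    integral_sub h1 h2]

lemma partialInt_sum (A : Finset J) {ι : Type*} [Fintype ι] {H : ι → (∀ j, T j) → ℝ}
    (hm : ∀ i, Measurable (H i)) (hi : ∀ i, Integrable (H i) (Measure.pi μ)) :
    partialInt μ A (fun x => ∑ i, H i x) =ᵐ[Measure.pi μ]
      fun x => ∑ i, partialInt μ A (H i) x := by
  have := fun i => ae_integrable_piecewise A (hi i)
  rw [← ae_all_iff] at this
  filter_upwards [this] with x h1
  rw [partialInt_eq A (by fun_prop), integral_finsetSum _ fun i _ => h1 i]
  simp_rw [partialInt_eq A (hm _)]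

lemma partialInt_const (A : Finset J) (c : ℝ) (x : ∀ j, T j) :
    partialInt μ A (fun _ => c) x = c := by
  simp [partialInt]

lemma sq_integral_le {α : Type*} [MeasurableSpace α] {P : Measure α} [IsProbabilityMeasure P]
    {f : α → ℝ} (hf : MemLp f 2 P) : (∫ x, f x ∂P) ^ 2 ≤ ∫ x, f x ^ 2 ∂P := by
  have h1 := variance_eq_sub hf
  have h2 := variance_nonneg f P
  simp only [Pi.pow_apply] at h1
  linarith

/-- Jensen's inequality on almost every fibre: the square of a partial integral is at most the
partial integral of the square. -/
lemma memLp_partialInt (A : Finset J) (hFm : Measurable F) (hF : MemLp F 2 (Measure.pi μ)) :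
    MemLp (partialInt μ A F) 2 (Measure.pi μ) := by
  have hm := measurable_partialInt (μ := μ) A hFm
  rw [memLp_two_iff_integrable_sq hm.aestronglyMeasurable]
  have hsq := hF.integrable_sq
  have h2 : Measurable fun x => F x ^ 2 := by fun_prop
  refine (integrable_partialInt A h2 hsq).mono' (hm.pow_const 2).aestronglyMeasurable ?_
  filter_upwards [ae_integrable_piecewise A hsq] with x hx
  have hxm : Measurable fun w => F (A.piecewise w x) :=
    hFm.comp ((measurable_piecewise_prod A).comp measurable_prodMk_left)
  rw [Real.norm_of_nonneg (sq_nonneg _), partialInt_eq A hFm, partialInt_eq A h2]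
  exact sq_integral_le ((memLp_two_iff_integrable_sq hxm.aestronglyMeasurable).2 hx)

/-- `partialInt μ A` is conditional expectation given the coordinates outside `A`, hence an
orthogonal projection: the second factor is constant under resampling `A` and can be pulled out. -/
lemma integral_mul_partialInt (A : Finset J) (hFm : Measurable F) (hGm : Measurable G)
    (hF : MemLp F 2 (Measure.pi μ)) (hG : MemLp G 2 (Measure.pi μ)) :
    ∫ x, F x * partialInt μ A G x ∂(Measure.pi μ) =
      ∫ x, partialInt μ A F x * partialInt μ A G x ∂(Measure.pi μ) := by
  have hm := measurable_partialInt (μ := μ) A hGm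
  have hi : Integrable (fun x => F x * partialInt μ A G x) (Measure.pi μ) :=
    hF.integrable_mul (memLp_partialInt A hGm hG)
  rw [← integral_partialInt (F := fun x => F x * partialInt μ A G x) A (hFm.mul hm) hi]
  congr with x
  rw [partialInt_eq (F := fun x => F x * partialInt μ A G x) A (hFm.mul hm)]
  simp_rw [partialInt_piecewise, integral_mul_const, partialInt_eq A hFm]

/-- The variance of `μ_{Bᶜ}(F)`, the part of `F` explained by the coordinates in `B`. -/
def blockVar (μ : ∀ j, Measure (T j)) (B : Finset J) (F : (∀ j, T j) → ℝ) : ℝ :=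
  ∫ x, (partialInt μ Bᶜ F x - ∫ z, F z ∂(Measure.pi μ)) ^ 2 ∂(Measure.pi μ)

lemma blockVar_empty (hFm : Measurable F) : blockVar μ ∅ F = 0 := by
  simp [blockVar, partialInt_univ hFm]

lemma blockVar_univ (hFm : Measurable F) :
    blockVar μ Finset.univ F = variance F (Measure.pi μ) := by
  simp [blockVar, partialInt_empty hFm, variance_eq_integral hFm.aemeasurable]

lemma blockVar_eq_sub (B : Finset J) (hFm : Measurable F) (hF : MemLp F 2 (Measure.pi μ)) :
    blockVar μ B F = ∫ x, F x * partialInt μ Bᶜ F x ∂(Measure.pi μ) -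
      (∫ z, F z ∂(Measure.pi μ)) ^ 2 := by
  rw [integral_mul_partialInt Bᶜ hFm hFm hF hF, blockVar,
    ← integral_partialInt Bᶜ hFm (hF.integrable one_le_two),
    ← variance_eq_integral (measurable_partialInt _ hFm).aemeasurable,
    variance_eq_sub (memLp_partialInt _ hFm hF)]
  simp [pow_two]

/-- Integrating out first `Aᶜ` and then `A \ B` integrates out exactly `Bᶜ`, so the quantity does
not depend on `A`. -/
lemma sigmaSq_partialInt {A B : Finset J} (hBA : B ⊆ A) (hFm : Measurable F)
    (hF : Integrable F (Measure.pi μ)) :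
    sigmaSq μ A B (partialInt μ Aᶜ F) = blockVar μ B F := by
  have h1 : A \ B ∪ Aᶜ = Bᶜ := by
    ext j
    have := @hBA j
    simp only [Finset.mem_union, Finset.mem_sdiff, Finset.mem_compl]
    tauto
  have h2 : A ∪ Aᶜ = Finset.univ := Finset.union_compl A
  unfold sigmaSq blockVar
  refine integral_congr_ae ?_
  filter_upwards [partialInt_partialInt (A \ B) Aᶜ hFm hF, partialInt_partialInt A Aᶜ hFm hF]
    with x hx1 hx2
  rw [hx1, hx2, h1, h2, partialInt_univ hFm]

lemma sigmaProdSq_eq : sigmaProdSq μ F = ∑ k, blockVar μ {k} F := rfl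

lemma prodVar_eq (hFm : Measurable F) (hF : Integrable F (Measure.pi μ)) (a N : ℝ) :
    prodVar μ F a N = ∑ A : Finset J,
      (∑ B ∈ A.powerset, (-1 : ℝ) ^ (A.card - B.card) * blockVar μ B F) *
        ((a * N)⁻¹) ^ A.card := by
  unfold prodVar
  rw [Finset.sum_filter]
  refine Finset.sum_congr rfl fun A _ => ?_
  split_ifs with h
  · rw [div_eq_mul_inv, ← mul_pow, inv_pow]
    congr 1
    refine Finset.sum_congr rfl fun B hB => ?_
    rw [sigmaSq_partialInt (Finset.mem_powerset.1 hB) hFm hF]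
  -- The empty set contributes zero, so the sum may run over all subsets.
  · rw [Finset.not_nonempty_iff_eq_empty.1 h]
    simp [blockVar_empty hFm]

/-- Möbius inversion over the lattice of finite subsets. -/
lemma sum_powerset_mobius (V : Finset J → ℝ) (r : ℝ) :
    ∑ A : Finset J, (∑ B ∈ A.powerset, (-1 : ℝ) ^ (A.card - B.card) * V B) * r ^ A.card =
      ∑ B : Finset J, V B * (r ^ B.card * (1 - r) ^ (Bᶜ).card) := by
  have key : ∀ B : Finset J, r ^ B.card * (1 - r) ^ (Bᶜ).card =
      ∑ A : Finset J, if B ⊆ A then (-1 : ℝ) ^ (A.card - B.card) * r ^ A.card else 0 := by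
    intro B
    -- Each factor of the left side is written as a sum: r + 0 for j in `B`, and -r + 1 otherwise.
    -- Expanding, `A` is the set of indices where the first summand is taken; the summand 0 removes
    -- every `A` that does not contain `B`.
    have h := Finset.prod_add (fun j => if j ∈ B then r else -r)
      (fun j => if j ∈ B then 0 else 1) (Finset.univ : Finset J)
    have hl : ∏ j : J, ((if j ∈ B then r else -r) + (if j ∈ B then 0 else 1)) =
        r ^ B.card * (1 - r) ^ (Bᶜ).card := by
      rw [← Finset.prod_mul_prod_compl B, ← Finset.prod_const, ← Finset.prod_const]
      congr 1
      · exact Finset.prod_congr rfl fun j hj => by simp [hj]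
      · refine Finset.prod_congr rfl fun j hj => ?_
        rw [Finset.mem_compl] at hj
        simp [hj]; ring
    rw [← hl, h, Finset.powerset_univ]
    refine Finset.sum_congr rfl fun A _ => ?_
    split_ifs with hBA
    · have h1 : ∏ j ∈ Finset.univ \ A, (if j ∈ B then (0 : ℝ) else 1) = 1 :=
        Finset.prod_eq_one fun j hj => by
          rw [Finset.mem_sdiff] at hj
          rw [if_neg fun h => hj.2 (hBA h)]
      rw [h1, mul_one, ← Finset.prod_sdiff hBA]
      have h2 : ∏ j ∈ A \ B, (if j ∈ B then r else -r) = (-r) ^ (A.card - B.card) := by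
        rw [← Finset.card_sdiff_of_subset hBA, ← Finset.prod_const]
        exact Finset.prod_congr rfl fun j hj => by simp [(Finset.mem_sdiff.1 hj).2]
      have h3 : ∏ j ∈ B, (if j ∈ B then r else -r) = r ^ B.card := by
        rw [← Finset.prod_const]
        exact Finset.prod_congr rfl fun j hj => by simp [hj]
      rw [h2, h3, neg_pow, mul_assoc, ← pow_add, Nat.sub_add_cancel (Finset.card_le_card hBA)]
    · obtain ⟨j, hjB, hjA⟩ := Finset.not_subset.1 hBA
      rw [Finset.prod_eq_zero (s := Finset.univ \ A) (i := j) (by simp [hjA]) (by simp [hjB]),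
        mul_zero]
  simp_rw [key, Finset.mul_sum, Finset.sum_mul]
  rw [Finset.sum_comm (s := (Finset.univ : Finset (Finset J)))]
  refine Finset.sum_congr rfl fun A _ => ?_
  rw [← Finset.sum_subset (Finset.subset_univ A.powerset)]
  · refine Finset.sum_congr rfl fun B hB => ?_
    rw [if_pos (Finset.mem_powerset.1 hB)]
    ring
  · intro B _ hB
    rw [if_neg (by simpa using hB), mul_zero]

end Product

/-! ### Exact moments of the average over permuted tuples -/

section Sample

variable {J : Type*} [Fintype J] [DecidableEq J] {T : J → Type*} [∀ j, MeasurableSpace (T j)]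
  {μ : ∀ j, Measure (T j)} [∀ j, IsProbabilityMeasure (μ j)]
  {Ω : Type*} [MeasurableSpace Ω] {P : Measure Ω} [IsProbabilityMeasure P]
  {Z : ℕ → Ω → ∀ j, T j} {F : (∀ j, T j) → ℝ}

/-- An i.i.d. sequence of samples from the product law `∏ j, μ j`. -/
structure IsProductSample (μ : ∀ j, Measure (T j)) (Z : ℕ → Ω → ∀ j, T j) (P : Measure Ω) :
    Prop where
  measurable : ∀ l, Measurable (Z l)
  indep : iIndepFun Z P
  law : ∀ l, P.map (Z l) = Measure.pi μ

/-- The permuted tuple whose `j`-th component is the `j`-th component of the sample `Z (m j)`. -/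
def tuple (Z : ℕ → Ω → ∀ j, T j) (m : J → ℕ) (ω : Ω) : ∀ j, T j := fun j => Z (m j) ω j

/-- The average of `F` over all permuted tuples of the first `n` samples. -/
def vstat (F : (∀ j, T j) → ℝ) (Z : ℕ → Ω → ∀ j, T j) (n : ℕ) (ω : Ω) : ℝ :=
  (1 / (n : ℝ) ^ Fintype.card J) * ∑ m : J → Fin n, F (tuple Z (fun j => m j) ω)

namespace IsProductSample

variable (h : IsProductSample μ Z P)
include h

lemma law_apply (l : ℕ) (j : J) : P.map (fun ω => Z l ω j) = μ j := by
  have := (measurePreserving_eval μ j).map_eq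
  rw [← this, ← h.law l, Measure.map_map (measurable_pi_apply j) (h.measurable l)]
  rfl

lemma measurable_apply (l : ℕ) (j : J) : Measurable (fun ω => Z l ω j) :=
  (measurable_pi_apply j).comp (h.measurable l)

/-- Samples are independent of each other, and the coordinates within one sample are independent
because its law is a product. -/
lemma iIndepFun_apply : iIndepFun (fun (p : ℕ × J) ω => Z p.1 ω p.2) P := by
  refine iIndepFun_uncurry' (X := fun l j ω => Z l ω j) h.measurable_apply h.indep fun l => ?_
  rw [iIndepFun_iff_map_fun_eq_pi_map fun j => (h.measurable_apply l j).aemeasurable]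
  simp_rw [h.law_apply]
  exact h.law l

lemma map_comp_injective {κ : Type*} [Fintype κ] (g : κ → ℕ × J) (hg : Function.Injective g) :
    P.map (fun ω k => Z (g k).1 ω (g k).2) = Measure.pi fun k => μ (g k).2 := by
  rw [(h.iIndepFun_apply.precomp hg).map_fun_eq_pi_map
    fun k => (h.measurable_apply _ _).aemeasurable]
  congr 1
  ext1 k
  exact h.law_apply _ _

lemma measurable_tuple (m : J → ℕ) : Measurable (tuple Z m) :=
  measurable_pi_iff.2 fun _ => h.measurable_apply _ _

lemma map_tuple (m : J → ℕ) : P.map (tuple Z m) = Measure.pi μ :=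
  h.map_comp_injective (fun j => (m j, j)) fun _ _ hij => (Prod.ext_iff.1 hij).2

lemma measurePreserving_tuple (m : J → ℕ) : MeasurePreserving (tuple Z m) P (Measure.pi μ) :=
  ⟨h.measurable_tuple m, h.map_tuple m⟩

lemma integral_tuple (m : J → ℕ) (hFm : Measurable F) :
    ∫ ω, F (tuple Z m ω) ∂P = ∫ x, F x ∂(Measure.pi μ) := by
  rw [← h.map_tuple m, integral_map (h.measurable_tuple m).aemeasurable hFm.aestronglyMeasurable]

lemma memLp_tuple (m : J → ℕ) (hF : MemLp F 2 (Measure.pi μ)) :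
    MemLp (fun ω => F (tuple Z m ω)) 2 P :=
  hF.comp_measurePreserving (h.measurePreserving_tuple m)

/-- On `A` the second tuple uses entries of the array disjoint from all those used by the first. -/
lemma map_tuple_prod (m m' : J → ℕ) (A : Finset J) (hA : ∀ j ∈ A, m j ≠ m' j) :
    P.map (fun ω => (tuple Z m ω, fun j : A => tuple Z m' ω j)) =
      (Measure.pi μ).prod (subLaw μ A) := by
  classical
  have hmeas : Measurable fun ω => fun j : A => tuple Z m' ω j :=
    measurable_pi_iff.2 fun _ => h.measurable_apply _ _
  have hlaw : P.map (fun ω => fun j : A => tuple Z m' ω j) = subLaw μ A :=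
    h.map_comp_injective (fun j : A => (m' j, (j : J))) fun _ _ hij =>
      Subtype.ext (Prod.ext_iff.1 hij).2
  let S : Finset (ℕ × J) := Finset.univ.image fun j => (m j, j)
  let R : Finset (ℕ × J) := A.image fun j => (m' j, j)
  have hSR : Disjoint S R := by
    rw [Finset.disjoint_left]
    intro p hp hp'
    simp only [S, R, Finset.mem_image, Finset.mem_univ, true_and] at hp hp'
    obtain ⟨j, rfl⟩ := hp
    obtain ⟨j', hj', he⟩ := hp'
    obtain ⟨h1, h2⟩ := Prod.ext_iff.1 he
    simp only at h1 h2
    subst h2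
    exact hA _ hj' h1.symm
  have hind := h.iIndepFun_apply.indepFun_finset S R hSR fun p => h.measurable_apply _ _
  have hS : ∀ j, (m j, j) ∈ S := fun j => Finset.mem_image_of_mem _ (Finset.mem_univ j)
  have hR : ∀ j : A, (m' j, (j : J)) ∈ R := fun j => Finset.mem_image_of_mem _ j.2
  have hind2 := hind.comp
    (φ := fun u (j : J) => u ⟨(m j, j), hS j⟩) (ψ := fun u (j : A) => u ⟨(m' j, (j : J)), hR j⟩)
    (by fun_prop) (by fun_prop)
  have := (indepFun_iff_map_prod_eq_prod_map_map (h.measurable_tuple m).aemeasurable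
    hmeas.aemeasurable).1 hind2
  rw [this, h.map_tuple, hlaw]

/-- The second tuple is the first with the coordinates of disagreement resampled afresh. Integrating
out these fresh coordinates first produces the partial integral. -/
lemma integral_tuple_mul_tuple (m m' : J → ℕ) (hF : MemLp F 2 (Measure.pi μ)) :
    ∫ ω, F (tuple Z m ω) * F (tuple Z m' ω) ∂P =
      ∫ x, F x * partialInt μ (Finset.univ.filter fun j => m j ≠ m' j) F x ∂(Measure.pi μ) := by
  set A := Finset.univ.filter fun j => m j ≠ m' j with hA
  have hupd : ∀ ω, tuple Z m' ω =
      Function.updateFinset (tuple Z m ω) A (fun j : A => tuple Z m' ω j) := by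
    intro ω
    ext j
    by_cases hj : m j = m' j
    · have : j ∉ A := by simp [hA, hj]
      simp [Function.updateFinset, this, tuple, hj]
    · have : j ∈ A := by simp [hA, hj]
      simp [Function.updateFinset, this]
  have hU := measurePreserving_updateFinset μ A
  have hI : Integrable (fun p : (∀ j, T j) × (∀ j : A, T j) =>
      F p.1 * F (Function.updateFinset p.1 A p.2)) ((Measure.pi μ).prod (subLaw μ A)) :=
    (hF.comp_measurePreserving measurePreserving_fst).integrable_mul
      (hF.comp_measurePreserving hU)
  have hmeas : Measurable fun ω => (tuple Z m ω, fun j : A => tuple Z m' ω j) :=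
    (h.measurable_tuple m).prodMk (measurable_pi_iff.2 fun _ => h.measurable_apply _ _)
  have hlaw := h.map_tuple_prod m m' A fun j hj => by simpa [hA] using hj
  calc ∫ ω, F (tuple Z m ω) * F (tuple Z m' ω) ∂P
      = ∫ ω, (fun p : (∀ j, T j) × (∀ j : A, T j) => F p.1 * F (Function.updateFinset p.1 A p.2))
          (tuple Z m ω, fun j : A => tuple Z m' ω j) ∂P := by
        refine integral_congr_ae (ae_of_all _ fun ω => ?_)
        simp only [← hupd ω]
    _ = ∫ p, F p.1 * F (Function.updateFinset p.1 A p.2) ∂((Measure.pi μ).prod (subLaw μ A)) := by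
        rw [← hlaw]
        refine (integral_map (f := fun p : (∀ j, T j) × (∀ j : A, T j) =>
          F p.1 * F (Function.updateFinset p.1 A p.2)) hmeas.aemeasurable ?_).symm
        rw [hlaw]
        exact hI.aestronglyMeasurable
    _ = _ := by
        rw [integral_prod _ hI]
        refine integral_congr_ae (ae_of_all _ fun x => ?_)
        simp only [integral_const_mul]
        rfl

lemma covariance_tuple (m m' : J → ℕ) (hFm : Measurable F) (hF : MemLp F 2 (Measure.pi μ)) :
    covariance (fun ω => F (tuple Z m ω)) (fun ω => F (tuple Z m' ω)) P =
      blockVar μ (Finset.univ.filter fun j => m j = m' j) F := by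
  rw [covariance_eq_sub (h.memLp_tuple m hF) (h.memLp_tuple m' hF), h.integral_tuple m hFm,
    h.integral_tuple m' hFm, blockVar_eq_sub _ hFm hF, Finset.compl_filter, ← pow_two]
  congr 1
  exact h.integral_tuple_mul_tuple m m' hF

lemma memLp_vstat (n : ℕ) (hF : MemLp F 2 (Measure.pi μ)) : MemLp (vstat F Z n) 2 P :=
  (memLp_finsetSum _ fun _ _ => h.memLp_tuple _ hF).const_mul _

lemma integrable_vstat (n : ℕ) (hF : Integrable F (Measure.pi μ)) :
    Integrable (vstat F Z n) P :=
  (integrable_finsetSum _ fun _ _ =>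
    (h.measurePreserving_tuple _).integrable_comp_of_integrable hF).const_mul _

lemma measurable_vstat (n : ℕ) (hFm : Measurable F) : Measurable (vstat F Z n) :=
  (Finset.measurable_fun_sum _ fun _ _ => hFm.comp (h.measurable_tuple _)).const_mul _

lemma integral_vstat {n : ℕ} (hn : 0 < n) (hFm : Measurable F)
    (hF : Integrable F (Measure.pi μ)) :
    ∫ ω, vstat F Z n ω ∂P = ∫ x, F x ∂(Measure.pi μ) := by
  unfold vstat
  rw [integral_const_mul, integral_finsetSum]
  swap
  · exact fun _ _ => (h.measurePreserving_tuple _).integrable_comp_of_integrable hF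
  simp_rw [h.integral_tuple _ hFm]
  have : (n : ℝ) ≠ 0 := by positivity
  simp
  field_simp

omit h in
-- Each index in the agreement set leaves n choices for the pair of values, and each index outside
-- it leaves n(n - 1).
lemma sum_sum_agree (V : Finset J → ℝ) (n : ℕ) :
    ∑ m : J → Fin n, ∑ m' : J → Fin n,
        V (Finset.univ.filter fun j => (m j : ℕ) = (m' j : ℕ)) =
      ∑ B : Finset J, V B * ((n : ℝ) ^ B.card * (n * (n - 1) : ℝ) ^ (Bᶜ).card) := by
  -- The product over j is the indicator that the agreement set is `B`; in this form the sum over m'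
  -- factors over coordinates.
  have h1 : ∀ m m' : J → Fin n, V (Finset.univ.filter fun j => (m j : ℕ) = (m' j : ℕ)) =
      ∑ B : Finset J, V B * ∏ j, (if j ∈ B then (if m j = m' j then (1 : ℝ) else 0) else
        (if m j = m' j then 0 else 1)) := by
    intro m m'
    rw [Finset.sum_eq_single (Finset.univ.filter fun j => (m j : ℕ) = (m' j : ℕ))]
    · rw [Finset.prod_eq_one, mul_one]
      intro j _
      by_cases hj : m j = m' j
      · simp [hj]
      · have : (m j : ℕ) ≠ m' j := fun hh => hj (Fin.ext hh)
        simp [hj, this]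
    · intro B _ hB
      obtain ⟨j, hj⟩ : ∃ j, ¬ (j ∈ B ↔ m j = m' j) := by
        by_contra hcon
        push Not at hcon
        refine hB (Finset.ext fun j => ?_)
        simp [hcon j, Fin.ext_iff]
      rw [Finset.prod_eq_zero (Finset.mem_univ j), mul_zero]
      by_cases h2 : j ∈ B <;> by_cases h3 : m j = m' j <;> simp_all
    · simp
  simp_rw [h1]
  have h2 : ∀ m : J → Fin n, ∑ m' : J → Fin n, ∑ B : Finset J, V B *
      ∏ j, (if j ∈ B then (if m j = m' j then (1 : ℝ) else 0) else
        (if m j = m' j then 0 else 1)) =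
      ∑ B : Finset J, V B * (n - 1 : ℝ) ^ (Bᶜ).card := by
    intro m
    rw [Finset.sum_comm]
    refine Finset.sum_congr rfl fun B _ => ?_
    rw [← Finset.mul_sum]
    congr 1
    have := Finset.prod_univ_sum (fun _ : J => (Finset.univ : Finset (Fin n)))
      (fun j a => if j ∈ B then (if m j = a then (1 : ℝ) else 0) else (if m j = a then 0 else 1))
    rw [Fintype.piFinset_univ] at this
    rw [← this, ← Finset.prod_mul_prod_compl B, Finset.prod_eq_one, one_mul, ← Finset.prod_const]
    · refine Finset.prod_congr rfl fun j hj => ?_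
      rw [Finset.mem_compl] at hj
      have h3 : ∀ a : Fin n, (if m j = a then (0 : ℝ) else 1) = 1 - if m j = a then 1 else 0 := by
        intro a; split_ifs <;> simp
      simp only [hj, if_false, h3, Finset.sum_sub_distrib]
      simp
    · intro j hj
      simp [hj]
  simp_rw [h2]
  rw [Finset.sum_const, Finset.card_univ, Fintype.card_fun, Fintype.card_fin, nsmul_eq_mul,
    Finset.mul_sum]
  refine Finset.sum_congr rfl fun B _ => ?_
  rw [mul_pow, ← mul_assoc (_ ^ _), ← pow_add, Finset.card_add_card_compl]
  push_cast
  ring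

lemma variance_vstat {n : ℕ} (hn : 0 < n) (hFm : Measurable F) (hF : MemLp F 2 (Measure.pi μ)) :
    variance (vstat F Z n) P = ∑ B : Finset J,
      blockVar μ B F * ((n : ℝ)⁻¹ ^ B.card * (1 - (n : ℝ)⁻¹) ^ (Bᶜ).card) := by
  have h0 : (n : ℝ) ≠ 0 := by positivity
  unfold vstat
  rw [variance_const_mul, variance_fun_sum fun m => h.memLp_tuple _ hF]
  simp_rw [h.covariance_tuple _ _ hFm hF]
  rw [sum_sum_agree (fun B => blockVar μ B F), Finset.mul_sum]
  refine Finset.sum_congr rfl fun B _ => ?_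
  rw [← Finset.card_add_card_compl B, pow_add]
  have : (1 - (n : ℝ)⁻¹) = (n * (n - 1)) * ((n : ℝ)⁻¹) ^ 2 := by field_simp
  rw [this]
  simp only [mul_pow, inv_pow, div_pow, one_pow]
  field_simp
  ring

lemma variance_vstat_eq_prodVar {n : ℕ} (hn : 0 < n) {a N : ℝ} (haN : (n : ℝ) = a * N)
    (hFm : Measurable F) (hF : MemLp F 2 (Measure.pi μ)) :
    variance (vstat F Z n) P = prodVar μ F a N := by
  rw [h.variance_vstat hn hFm hF, prodVar_eq hFm (hF.integrable one_le_two), sum_powerset_mobius,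
    haN]

/-- The shifted diagonal average `(1/n) ∑ l, F (Z (l + s 1), …)` with addition modulo `n`. -/
lemma variance_shift {n : ℕ} [NeZero n] (s : J → Fin n) (hFm : Measurable F)
    (hF : MemLp F 2 (Measure.pi μ)) [Nonempty J] :
    variance (fun ω => ∑ l : Fin n, F (tuple Z (fun j => (l + s j : Fin n)) ω)) P =
      n * variance F (Measure.pi μ) := by
  rw [variance_fun_sum fun l => h.memLp_tuple _ hF]
  simp_rw [h.covariance_tuple _ _ hFm hF]
  have : ∀ l l' : Fin n, blockVar μ (Finset.univ.filter fun j : J =>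
      ((l + s j : Fin n) : ℕ) = ((l' + s j : Fin n) : ℕ)) F =
      if l = l' then variance F (Measure.pi μ) else 0 := by
    -- A shift is injective in l, so distinct l, l' disagree in every coordinate and give covariance
    -- zero, while equal ones agree everywhere.
    intro l l'
    split_ifs with hl
    · subst hl
      simp [blockVar_univ hFm]
    · have : (Finset.univ.filter fun j : J =>
          ((l + s j : Fin n) : ℕ) = ((l' + s j : Fin n) : ℕ)) = ∅ := by
        refine Finset.filter_false_of_mem fun j _ hh => hl ?_
        exact add_right_cancel (Fin.ext hh)
      rw [this, blockVar_empty hFm]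
  simp_rw [this]
  simp

lemma variance_sum_diag (n : ℕ) (hFm : Measurable F) (hF : MemLp F 2 (Measure.pi μ)) :
    variance (fun ω => ∑ l : Fin n, F (Z l ω)) P = n * variance F (Measure.pi μ) := by
  rw [variance_fun_sum (X := fun (l : Fin n) ω => F (Z l ω)) fun l => h.memLp_tuple (fun _ => l) hF]
  have hc : ∀ l l' : Fin n, covariance (fun ω => F (Z l ω)) (fun ω => F (Z l' ω)) P =
      if l = l' then variance F (Measure.pi μ) else 0 := by
    intro l l'
    split_ifs with hl
    · subst hl
      rw [← blockVar_univ hFm]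
      simpa using! h.covariance_tuple (fun _ => l) (fun _ => l) hFm hF
    · refine IndepFun.covariance_eq_zero ?_ (h.memLp_tuple (fun _ => l) hF)
        (h.memLp_tuple (fun _ => l') hF)
      exact (h.indep.indepFun (fun hh => hl (Fin.ext hh))).comp hFm hFm
  simp_rw [hc]
  simp

/-- The set of tuples is covered uniformly by the n^|J| cyclically shifted diagonals. By convexity
of the square, averaging over the shifts cannot exceed the common variance of one diagonal average.
-/
lemma variance_vstat_le {n : ℕ} (hn : 0 < n) (hFm : Measurable F)
    (hF : MemLp F 2 (Measure.pi μ)) :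
    variance (vstat F Z n) P ≤ variance F (Measure.pi μ) / n := by
  have : NeZero n := ⟨hn.ne'⟩
  have h0 : (n : ℝ) ≠ 0 := by positivity
  rcases isEmpty_or_nonempty J with hJ | hJ
  · rw [h.variance_vstat hn hFm hF]
    rw [Finset.sum_eq_zero fun B _ => ?_]
    · exact div_nonneg (variance_nonneg _ _) (Nat.cast_nonneg n)
    · rw [Finset.eq_empty_of_isEmpty B, blockVar_empty hFm, zero_mul]
  -- For fixed l, adding l is a bijection of the tuples, so every tuple is counted n times.
  have hsum : ∀ ω, ∑ s : J → Fin n, ∑ l : Fin n, F (tuple Z (fun j => (l + s j : Fin n)) ω) =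
      n * ∑ m : J → Fin n, F (tuple Z (fun j => m j) ω) := by
    intro ω
    rw [Finset.sum_comm]
    have : ∀ l : Fin n, ∑ s : J → Fin n, F (tuple Z (fun j => (l + s j : Fin n)) ω) =
        ∑ m : J → Fin n, F (tuple Z (fun j => m j) ω) := fun l =>
      Fintype.sum_equiv (Equiv.addLeft (fun _ => l)) _ _ fun s => rfl
    simp [this]
  set D : (J → Fin n) → Ω → ℝ :=
    fun s ω => ∑ l : Fin n, F (tuple Z (fun j => (l + s j : Fin n)) ω) with hD
  have hDL : ∀ s, MemLp (D s) 2 P := fun s => memLp_finsetSum _ fun _ _ => h.memLp_tuple _ hF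
  have hv : vstat F Z n =
      fun ω => (1 / (n : ℝ) ^ (Fintype.card J + 1)) * ∑ s : J → Fin n, D s ω := by
    ext ω
    rw [hsum ω, vstat, pow_succ]
    field_simp
  -- Cauchy–Schwarz for the n^|J| centred diagonal sums; no information on their correlations is
  -- needed.
  have hcs : variance (fun ω => ∑ s : J → Fin n, D s ω) P ≤
      (n : ℝ) ^ Fintype.card J * ∑ s : J → Fin n, variance (D s) P := by
    have hint : ∀ s, Integrable (D s) P := fun s => (hDL s).integrable one_le_two
    have hm : ∀ s, AEMeasurable (D s) P := fun s => (hint s).aemeasurable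
    rw [variance_eq_integral (Finset.aemeasurable_fun_sum _ fun s _ => hm s),
      integral_finsetSum _ fun s _ => hint s]
    simp_rw [variance_eq_integral (hm _), ← Finset.sum_sub_distrib]
    have hsq : ∀ s, Integrable (fun ω => (D s ω - ∫ x, D s x ∂P) ^ 2) P := fun s =>
      ((hDL s).sub (memLp_const _)).integrable_sq
    rw [← integral_finsetSum _ fun s _ => hsq s, ← integral_const_mul]
    refine integral_mono ?_ ((integrable_finsetSum _ fun s _ => hsq s).const_mul _) fun ω => ?_
    · exact (memLp_finsetSum _ fun s _ => (hDL s).sub (memLp_const _)).integrable_sq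
    · have := sq_sum_le_card_mul_sum_sq (s := (Finset.univ : Finset (J → Fin n)))
        (f := fun s => D s ω - ∫ x, D s x ∂P)
      simpa using this
  rw [hv, variance_const_mul]
  have hDv : ∀ s, variance (D s) P = n * variance F (Measure.pi μ) := fun s =>
    h.variance_shift s hFm hF
  simp_rw [hDv] at hcs
  rw [Finset.sum_const, Finset.card_univ, Fintype.card_fun, Fintype.card_fin, nsmul_eq_mul] at hcs
  calc _ ≤ (1 / (n : ℝ) ^ (Fintype.card J + 1)) ^ 2 * _ :=
        mul_le_mul_of_nonneg_left hcs (sq_nonneg _)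
    _ = _ := by
        push_cast
        rw [pow_succ]
        field_simp
        ring

end IsProductSample

end Sample

/-! ### Strong law, and decomposition into first-order parts and remainder -/

section Sample

variable {J : Type*} [Fintype J] [DecidableEq J] {T : J → Type*} [∀ j, MeasurableSpace (T j)]
  {μ : ∀ j, Measure (T j)} [∀ j, IsProbabilityMeasure (μ j)]
  {Ω : Type*} [MeasurableSpace Ω] {P : Measure Ω} [IsProbabilityMeasure P]
  {Z : ℕ → Ω → ∀ j, T j} {F : (∀ j, T j) → ℝ}

/-- Random variables with a common mean and summable variances converge almost surely. -/
lemma ae_tendsto_of_summable_variance {Y : ℕ → Ω → ℝ} {c : ℝ} (hY : ∀ k, MemLp (Y k) 2 P)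
    (hc : ∀ k, ∫ ω, Y k ω ∂P = c) (hs : Summable fun k => variance (Y k) P) :
    ∀ᵐ ω ∂P, Tendsto (fun k => Y k ω) atTop (𝓝 c) := by
  have hint : ∀ k, Integrable (fun ω => (Y k ω - c) ^ 2) P := fun k =>
    ((hY k).sub (memLp_const c)).integrable_sq
  -- The squared deviations have a finite expected sum, so almost surely they are summable and tend
  -- to zero.
  have hfin : ∫⁻ ω, ∑' k, ENNReal.ofReal ((Y k ω - c) ^ 2) ∂P ≠ ⊤ := by
    rw [lintegral_tsum fun k => (hint k).aemeasurable.ennreal_ofReal]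
    have : ∀ k, ∫⁻ ω, ENNReal.ofReal ((Y k ω - c) ^ 2) ∂P = ENNReal.ofReal (variance (Y k) P) := by
      intro k
      rw [← ofReal_integral_eq_lintegral_ofReal (hint k) (ae_of_all _ fun _ => sq_nonneg _),
        variance_eq_integral (hY k).aemeasurable, hc k]
    simp_rw [this]
    exact hs.tsum_ofReal_ne_top
  have hmeas : AEMeasurable (fun ω => ∑' k, ENNReal.ofReal ((Y k ω - c) ^ 2)) P :=
    AEMeasurable.tsum fun k => (hint k).aemeasurable.ennreal_ofReal
  filter_upwards [ae_lt_top' hmeas hfin] with ω hω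
  have h1 := ENNReal.tendsto_atTop_zero_of_tsum_ne_top hω.ne
  have h2 := (ENNReal.tendsto_toReal ENNReal.zero_ne_top).comp h1
  have h3 : Tendsto (fun k => (Y k ω - c) ^ 2) atTop (𝓝 0) := by
    refine h2.congr fun k => ?_
    simp [ENNReal.toReal_ofReal (sq_nonneg _)]
  have h4 : Tendsto (fun k => |Y k ω - c|) atTop (𝓝 0) := by
    have := (Real.continuous_sqrt.tendsto 0).comp h3
    simpa [Function.comp_def, Real.sqrt_sq_eq_abs] using this
  rw [tendsto_iff_norm_sub_tendsto_zero]
  simpa using h4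

/-- For a monotone sequence, convergence of `S n / n ^ d` along the squares implies convergence. -/
lemma tendsto_div_pow_of_tendsto_sq {S : ℕ → ℝ} (hS : Monotone S) (h0 : ∀ n, 0 ≤ S n) (d : ℕ)
    {c : ℝ} (hc : Tendsto (fun k : ℕ => S ((k + 1) ^ 2) / (((k + 1) ^ 2 : ℕ) : ℝ) ^ d) atTop (𝓝 c)) :
    Tendsto (fun n => S n / (n : ℝ) ^ d) atTop (𝓝 c) := by
  set u : ℕ → ℝ := fun k => S (k ^ 2) / ((k ^ 2 : ℕ) : ℝ) ^ d with hu
  have hu' : Tendsto u atTop (𝓝 c) := (tendsto_add_atTop_iff_nat 1).1 hc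
  -- With k the integer square root of n, monotonicity sandwiches S n / n^d between S(k²)/(k+1)^(2d)
  -- and S((k+1)²)/k^(2d). The ratio `ρ k` → 1 accounts for the mismatched denominators.
  set ρ : ℕ → ℝ := fun k => ((((k + 1 : ℕ) : ℝ) / k) ^ 2) ^ d with hρ
  have hρ1 : Tendsto ρ atTop (𝓝 1) := by
    have h1 : Tendsto (fun k : ℕ => ((k + 1 : ℕ) : ℝ) / k) atTop (𝓝 1) := by
      have h2 : Tendsto (fun k : ℕ => 1 + ((k : ℝ))⁻¹) atTop (𝓝 (1 + 0)) :=
        tendsto_const_nhds.add tendsto_inv_atTop_nhds_zero_nat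
      rw [add_zero] at h2
      refine h2.congr' ?_
      filter_upwards [eventually_gt_atTop 0] with k hk
      have : (k : ℝ) ≠ 0 := by positivity
      push_cast
      field_simp
    simpa [hρ] using (h1.pow 2).pow d
  have hsqrt : Tendsto Nat.sqrt atTop atTop :=
    tendsto_atTop.2 fun k => (eventually_ge_atTop (k ^ 2)).mono fun n hn => Nat.le_sqrt'.2 hn
  have hlow : Tendsto (fun n => u (Nat.sqrt n) / ρ (Nat.sqrt n)) atTop (𝓝 c) := by
    simpa using! (hu'.div hρ1 one_ne_zero).comp hsqrt
  have hup : Tendsto (fun n => u (Nat.sqrt n + 1) * ρ (Nat.sqrt n)) atTop (𝓝 c) := by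
    simpa using! ((hu'.comp (tendsto_add_atTop_nat 1)).mul hρ1).comp hsqrt
  refine tendsto_of_tendsto_of_tendsto_of_le_of_le' hlow hup ?_ ?_
  all_goals
    filter_upwards [eventually_gt_atTop 0] with n hn
    have hk : 0 < Nat.sqrt n := Nat.sqrt_pos.2 hn
    have h1 : (Nat.sqrt n) ^ 2 ≤ n := Nat.sqrt_le' n
    have h2 : n ≤ (Nat.sqrt n + 1) ^ 2 := (Nat.lt_succ_sqrt' n).le
    set k := Nat.sqrt n
    have hk' : (0 : ℝ) < k := by exact_mod_cast hk
    have hn' : (0 : ℝ) < n := by exact_mod_cast hn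
    have h1' : (k : ℝ) ^ 2 ≤ n := by exact_mod_cast h1
    have h2' : (n : ℝ) ≤ ((k : ℝ) + 1) ^ 2 := by exact_mod_cast h2
  · have : u k / ρ k = S (k ^ 2) / ((((k : ℝ) + 1) ^ 2) ^ d) := by
      simp only [hu, hρ, div_pow]
      push_cast
      field_simp
    rw [this]
    have := hS h1
    have := h0 n
    gcongr
  · have : u (k + 1) * ρ k = S ((k + 1) ^ 2) / (((k : ℝ) ^ 2) ^ d) := by
      simp only [hu, hρ, div_pow]
      push_cast
      field_simp
    rw [this]
    have := hS h2
    have := h0 ((k + 1) ^ 2)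
    gcongr

lemma vstat_sub {F G : (∀ j, T j) → ℝ} (n : ℕ) (ω : Ω) :
    vstat (fun x => F x - G x) Z n ω = vstat F Z n ω - vstat G Z n ω := by
  simp [vstat, Finset.sum_sub_distrib, mul_sub]

lemma vstat_sum {κ : Type*} [Fintype κ] {H : κ → (∀ j, T j) → ℝ} (n : ℕ) (ω : Ω) :
    vstat (fun x => ∑ k, H k x) Z n ω = ∑ k, vstat (H k) Z n ω := by
  simp only [vstat, ← Finset.mul_sum]
  rw [Finset.sum_comm]

lemma vstat_const {n : ℕ} (hn : 0 < n) (c : ℝ) (ω : Ω) :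
    vstat (fun _ : ∀ j, T j => c) Z n ω = c := by
  have : (n : ℝ) ≠ 0 := by positivity
  simp only [vstat, Finset.sum_const, Finset.card_univ, Fintype.card_fun, Fintype.card_fin,
    nsmul_eq_mul]
  push_cast
  field_simp

/-- For a function of a single coordinate the average over permuted tuples is the plain average. -/
lemma vstat_of_coord {n : ℕ} (hn : 0 < n) (k : J) (hF : ∀ x y : ∀ j, T j, x k = y k → F x = F y)
    (ω : Ω) : vstat F Z n ω = (1 / (n : ℝ)) * ∑ l : Fin n, F (Z l ω) := by
  have h0 : (n : ℝ) ≠ 0 := by positivity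
  -- Padding with factors 1 lets the sum over m factor; every coordinate other than k then
  -- contributes n, cancelling all but one power of n.
  have h1 : ∀ m : J → Fin n, F (tuple Z (fun j => m j) ω) =
      ∏ j, (if j = k then F (Z (m j) ω) else 1) := by
    intro m
    rw [Finset.prod_ite_eq' Finset.univ k fun j => F (Z (m j) ω), if_pos (Finset.mem_univ k)]
    exact hF _ _ rfl
  have h2 := Finset.prod_univ_sum (fun _ : J => (Finset.univ : Finset (Fin n)))
    (fun j a => if j = k then F (Z a ω) else 1)
  rw [Fintype.piFinset_univ] at h2
  unfold vstat
  simp_rw [h1]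
  rw [← h2, ← Finset.mul_prod_erase _ _ (Finset.mem_univ k)]
  have h3 : ∏ j ∈ Finset.univ.erase k, ∑ a : Fin n, (if j = k then F (Z a ω) else 1) =
      (n : ℝ) ^ (Fintype.card J - 1) := by
    rw [← Finset.card_univ, ← Finset.card_erase_of_mem (Finset.mem_univ k), ← Finset.prod_const]
    refine Finset.prod_congr rfl fun j hj => ?_
    simp [(Finset.mem_erase.1 hj).1]
  have h4 : (n : ℝ) ^ Fintype.card J = n ^ (Fintype.card J - 1) * n := by
    rw [← pow_succ, Nat.sub_add_cancel (Fintype.card_pos_iff.2 ⟨k⟩)]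
  rw [h3, h4]
  simp only [if_true]
  field_simp

lemma monotone_sum_tuple (hF : ∀ x, 0 ≤ F x) (ω : Ω) :
    Monotone fun n : ℕ => ∑ m : J → Fin n, F (tuple Z (fun j => m j) ω) := by
  intro n n' hn
  let e : (J → Fin n) ↪ (J → Fin n') :=
    ⟨fun m j => Fin.castLE hn (m j), fun m m' hm => funext fun j =>
      Fin.castLE_injective hn (congrFun hm j)⟩
  have : ∑ m : J → Fin n, F (tuple Z (fun j => m j) ω) =
      ∑ m ∈ Finset.univ.map e, F (tuple Z (fun j => m j) ω) := by
    rw [Finset.sum_map]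
    rfl
  simp only [this]
  exact Finset.sum_le_sum_of_subset_of_nonneg (Finset.subset_univ _) fun _ _ _ => hF _

namespace IsProductSample

variable (h : IsProductSample μ Z P)
include h

/-- The bound Var(F)/n is not summable in n but is along the squares. Nonnegativity makes the
unnormalised sums increasing, which transfers the limit to all n. -/
lemma ae_tendsto_vstat_of_nonneg (hFm : Measurable F) (hF : MemLp F 2 (Measure.pi μ))
    (h0 : ∀ x, 0 ≤ F x) :
    ∀ᵐ ω ∂P, Tendsto (fun n => vstat F Z n ω) atTop (𝓝 (∫ x, F x ∂(Measure.pi μ))) := by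
  have hs : Summable fun k : ℕ => variance (vstat F Z ((k + 1) ^ 2)) P := by
    have h1 : Summable fun k : ℕ => variance F (Measure.pi μ) / (((k + 1) ^ 2 : ℕ) : ℝ) := by
      have := ((summable_nat_add_iff 1).2 (Real.summable_nat_pow_inv.2 one_lt_two)).mul_left
        (variance F (Measure.pi μ))
      refine this.congr fun k => ?_
      push_cast
      rfl
    exact h1.of_nonneg_of_le (fun k => variance_nonneg _ _)
      fun k => h.variance_vstat_le (by positivity) hFm hF
  filter_upwards [ae_tendsto_of_summable_variance (fun k => h.memLp_vstat _ hF)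
    (fun k => h.integral_vstat (by positivity) hFm (hF.integrable one_le_two)) hs] with ω hω
  have := tendsto_div_pow_of_tendsto_sq (monotone_sum_tuple (Z := Z) h0 ω)
    (fun n => Finset.sum_nonneg fun _ _ => h0 _) (Fintype.card J)
    (c := ∫ x, F x ∂(Measure.pi μ)) (hω.congr fun k => by rw [vstat]; ring)
  exact this.congr fun n => by rw [vstat]; ring

/-- Strong consistency of the average over permuted tuples. -/
lemma ae_tendsto_vstat (hFm : Measurable F) (hF : MemLp F 2 (Measure.pi μ)) :
    ∀ᵐ ω ∂P, Tendsto (fun n => vstat F Z n ω) atTop (𝓝 (∫ x, F x ∂(Measure.pi μ))) := by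
  have h1 := h.ae_tendsto_vstat_of_nonneg (F := fun x => max (F x) 0) (by fun_prop) hF.pos_part
    fun x => le_max_right _ _
  have h2 := h.ae_tendsto_vstat_of_nonneg (F := fun x => max (-F x) 0) (by fun_prop) hF.neg_part
    fun x => le_max_right _ _
  have he : F = fun x => max (F x) 0 - max (-F x) 0 := by
    ext x
    rcases le_total 0 (F x) with hx | hx <;> simp [hx]
  filter_upwards [h1, h2] with ω hω1 hω2
  have h3 := hω1.sub hω2
  rw [← integral_sub (hF.pos_part.integrable one_le_two) (hF.neg_part.integrable one_le_two),
    ← he] at h3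
  refine h3.congr fun n => ?_
  rw [← vstat_sub, ← he]

end IsProductSample

/-- The first-order part `μ_{{k}ᶜ}(F) - μ(F)` of `F` in the coordinate `k`. -/
def firstOrder (μ : ∀ j, Measure (T j)) (F : (∀ j, T j) → ℝ) (k : J) (x : ∀ j, T j) : ℝ :=
  partialInt μ {k}ᶜ F x - ∫ z, F z ∂(Measure.pi μ)

/-- The remainder of `F` after removal of its mean and of its first-order parts. -/
def remainder (μ : ∀ j, Measure (T j)) (F : (∀ j, T j) → ℝ) (x : ∀ j, T j) : ℝ :=
  F x - ∫ z, F z ∂(Measure.pi μ) - ∑ k, firstOrder μ F k x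

lemma measurable_firstOrder (hFm : Measurable F) (k : J) : Measurable (firstOrder μ F k) :=
  (measurable_partialInt _ hFm).sub_const _

lemma memLp_firstOrder (hFm : Measurable F) (hF : MemLp F 2 (Measure.pi μ)) (k : J) :
    MemLp (firstOrder μ F k) 2 (Measure.pi μ) :=
  (memLp_partialInt _ hFm hF).sub (memLp_const _)

lemma firstOrder_congr (k : J) {x y : ∀ j, T j} (hxy : x k = y k) :
    firstOrder μ F k x = firstOrder μ F k y := by
  unfold firstOrder
  rw [partialInt_congr_of_eqOn]
  intro j hj
  simp only [Finset.mem_compl, Finset.mem_singleton, not_not] at hj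
  subst hj
  exact hxy

lemma measurable_remainder (hFm : Measurable F) : Measurable (remainder μ F) :=
  (hFm.sub_const _).sub (Finset.measurable_fun_sum _ fun k _ => measurable_firstOrder hFm k)

lemma memLp_remainder (hFm : Measurable F) (hF : MemLp F 2 (Measure.pi μ)) :
    MemLp (remainder μ F) 2 (Measure.pi μ) :=
  (hF.sub (memLp_const _)).sub (memLp_finsetSum _ fun k _ => memLp_firstOrder hFm hF k)

lemma integral_firstOrder (hFm : Measurable F) (hF : Integrable F (Measure.pi μ)) (k : J) :
    ∫ x, firstOrder μ F k x ∂(Measure.pi μ) = 0 := by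
  unfold firstOrder
  rw [integral_sub (integrable_partialInt _ hFm hF) (integrable_const _),
    integral_partialInt _ hFm hF]
  simp

/-- For k ≠ l the sets `{l}ᶜ` and `{k}ᶜ` cover all coordinates, so everything is integrated out and
the mean cancels. This is the orthogonality of the first-order parts. -/
lemma partialInt_firstOrder (hFm : Measurable F) (hF : Integrable F (Measure.pi μ)) (k l : J) :
    partialInt μ {l}ᶜ (firstOrder μ F k) =ᵐ[Measure.pi μ]
      fun x => if k = l then firstOrder μ F k x else 0 := by
  have h1 := partialInt_sub (μ := μ) ({l}ᶜ : Finset J)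
    (measurable_partialInt ({k}ᶜ : Finset J) hFm)
    (measurable_const (a := ∫ z, F z ∂(Measure.pi μ))) (integrable_partialInt _ hFm hF)
    (integrable_const _)
  filter_upwards [h1, partialInt_partialInt ({l}ᶜ : Finset J) ({k}ᶜ : Finset J) hFm hF]
    with x hx1 hx2
  have hx3 : partialInt μ {l}ᶜ (firstOrder μ F k) x = _ := hx1
  rw [hx3, hx2, partialInt_const]
  split_ifs with hkl
  · subst hkl
    rw [Finset.union_self]
    rfl
  · have : ({l}ᶜ ∪ {k}ᶜ : Finset J) = Finset.univ := by
      ext j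
      simp only [Finset.mem_union, Finset.mem_compl, Finset.mem_singleton, Finset.mem_univ,
        iff_true]
      by_contra hcon
      push Not at hcon
      exact hkl (hcon.2.symm.trans hcon.1)
    rw [this, partialInt_univ hFm, sub_self]

lemma integral_remainder (hFm : Measurable F) (hF : Integrable F (Measure.pi μ)) :
    ∫ x, remainder μ F x ∂(Measure.pi μ) = 0 := by
  have hi : ∀ k, Integrable (firstOrder μ F k) (Measure.pi μ) := fun k =>
    (integrable_partialInt _ hFm hF).sub (integrable_const _)
  unfold remainder
  rw [integral_sub (f := fun x => F x - ∫ z, F z ∂(Measure.pi μ)) (hF.sub (integrable_const _))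
      (integrable_finsetSum _ fun k _ => hi k),
    integral_sub hF (integrable_const _), integral_finsetSum _ fun k _ => hi k]
  simp [integral_firstOrder hFm hF]

/-- Projected onto coordinate l, the centred F and the sum of the first-order parts both become the
l-th first-order part. -/
lemma blockVar_singleton_remainder (hFm : Measurable F) (hF : Integrable F (Measure.pi μ))
    (l : J) : blockVar μ {l} (remainder μ F) = 0 := by
  have hi : ∀ k, Integrable (firstOrder μ F k) (Measure.pi μ) := fun k =>
    (integrable_partialInt _ hFm hF).sub (integrable_const _)
  have hm : ∀ k, Measurable (firstOrder μ F k) := measurable_firstOrder hFm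
  unfold blockVar
  rw [integral_remainder hFm hF]
  refine (integral_congr_ae ?_).trans (integral_zero _ ℝ)
  have h1 := partialInt_sub (μ := μ) ({l}ᶜ : Finset J) (F := fun x => F x - ∫ z, F z ∂(Measure.pi μ))
    (G := fun x => ∑ k, firstOrder μ F k x) (hFm.sub_const _)
    (Finset.measurable_fun_sum _ fun k _ => hm k) (hF.sub (integrable_const _))
    (integrable_finsetSum _ fun k _ => hi k)
  have h2 := partialInt_sub (μ := μ) ({l}ᶜ : Finset J) hFm
    (measurable_const (a := ∫ z, F z ∂(Measure.pi μ))) hF (integrable_const _)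
  have h3 := partialInt_sum (μ := μ) ({l}ᶜ : Finset J) hm hi
  have h4 := ae_all_iff.2 fun k => partialInt_firstOrder hFm hF k l
  filter_upwards [h1, h2, h3, h4] with x hx1 hx2 hx3 hx4
  have hx0 : partialInt μ {l}ᶜ (remainder μ F) x = _ := hx1
  rw [hx0, hx2, hx3, partialInt_const]
  simp_rw [hx4]
  simp [firstOrder]

lemma integral_firstOrder_mul (hFm : Measurable F) (hF : MemLp F 2 (Measure.pi μ)) (k l : J) :
    ∫ x, firstOrder μ F k x * firstOrder μ F l x ∂(Measure.pi μ) =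
      if k = l then blockVar μ {k} F else 0 := by
  split_ifs with hkl
  · subst hkl
    simp only [← pow_two]
    rfl
  · have hFi := hF.integrable one_le_two
    have h1 := partialInt_sub (μ := μ) ({l}ᶜ : Finset J) hFm
      (measurable_const (a := ∫ z, F z ∂(Measure.pi μ))) hFi (integrable_const _)
    have h2 : ∫ x, firstOrder μ F k x * firstOrder μ F l x ∂(Measure.pi μ) =
        ∫ x, firstOrder μ F k x * partialInt μ {l}ᶜ (fun x => F x - ∫ z, F z ∂(Measure.pi μ)) x
          ∂(Measure.pi μ) := by
      refine integral_congr_ae ?_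
      filter_upwards [h1] with x hx
      rw [hx, partialInt_const]
      rfl
    rw [h2, integral_mul_partialInt _ (measurable_firstOrder hFm k) (hFm.sub_const _)
      (memLp_firstOrder hFm hF k) (hF.sub (memLp_const _))]
    refine (integral_congr_ae ?_).trans (integral_zero _ ℝ)
    filter_upwards [partialInt_firstOrder hFm hFi k l] with x hx
    rw [hx, if_neg hkl, zero_mul]

lemma variance_sum_firstOrder (hFm : Measurable F) (hF : MemLp F 2 (Measure.pi μ)) :
    variance (fun x => ∑ k, firstOrder μ F k x) (Measure.pi μ) = sigmaProdSq μ F := by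
  have hL := fun k => memLp_firstOrder hFm hF k
  rw [variance_fun_sum hL, sigmaProdSq_eq]
  have : ∀ k l, covariance (firstOrder μ F k) (firstOrder μ F l) (Measure.pi μ) =
      if k = l then blockVar μ {k} F else 0 := by
    intro k l
    rw [covariance_eq_sub (hL k) (hL l), integral_firstOrder hFm (hF.integrable one_le_two),
      zero_mul, sub_zero]
    exact integral_firstOrder_mul hFm hF k l
  simp_rw [this]
  simp

/-- Bessel's inequality for the first-order parts. -/
lemma sigmaProdSq_le_variance (hFm : Measurable F) (hF : MemLp F 2 (Measure.pi μ)) :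
    sigmaProdSq μ F ≤ variance F (Measure.pi μ) := by
  have hL := fun k => memLp_firstOrder hFm hF k
  have hs : MemLp (fun x => ∑ k, firstOrder μ F k x) 2 (Measure.pi μ) :=
    memLp_finsetSum _ fun k _ => hL k
  -- The covariance of F with its first-order sum equals the variance of that sum, so the variance
  -- of the difference is the difference of the variances.
  have h1 := variance_fun_sub hF hs
  have h2 : covariance F (fun x => ∑ k, firstOrder μ F k x) (Measure.pi μ) = sigmaProdSq μ F := by
    rw [covariance_fun_sum_right hL hF, sigmaProdSq_eq]
    refine Finset.sum_congr rfl fun k _ => ?_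
    rw [blockVar_eq_sub _ hFm hF, covariance_eq_sub hF (hL k),
      integral_firstOrder hFm (hF.integrable one_le_two), mul_zero, sub_zero]
    have h3 : Integrable (fun x => F x * partialInt μ {k}ᶜ F x) (Measure.pi μ) :=
      hF.integrable_mul (memLp_partialInt _ hFm hF)
    simp only [Pi.mul_apply, firstOrder, mul_sub]
    rw [integral_sub h3 ((hF.integrable one_le_two).mul_const _), integral_mul_const, pow_two]
  rw [h2, variance_sum_firstOrder hFm hF] at h1
  have h3 := variance_nonneg (fun x => F x - ∑ k, firstOrder μ F k x) (Measure.pi μ)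
  linarith

lemma vstat_remainder {n : ℕ} (hn : 0 < n) (ω : Ω) :
    vstat (remainder μ F) Z n ω = vstat F Z n ω - ∫ z, F z ∂(Measure.pi μ) -
      (1 / (n : ℝ)) * ∑ l : Fin n, ∑ k, firstOrder μ F k (Z l ω) := by
  have h1 : vstat (fun x => ∑ k, firstOrder μ F k x) Z n ω =
      (1 / (n : ℝ)) * ∑ l : Fin n, ∑ k, firstOrder μ F k (Z l ω) := by
    rw [vstat_sum, Finset.sum_comm, Finset.mul_sum]
    exact Finset.sum_congr rfl fun k _ => vstat_of_coord hn k (fun x y => firstOrder_congr k) ω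
  rw [← h1]
  unfold remainder
  rw [vstat_sub (F := fun x => F x - ∫ z, F z ∂(Measure.pi μ)), vstat_sub, vstat_const hn]

/-- The components of the remainder vanish for |B| ≤ 1, and for |B| ≥ 2 the factor n · n^(-|B|)
tends to zero. -/
lemma IsProductSample.tendsto_mul_variance_remainder (h : IsProductSample μ Z P)
    (hFm : Measurable F) (hF : MemLp F 2 (Measure.pi μ)) :
    Tendsto (fun n : ℕ => n * variance (vstat (remainder μ F) Z n) P) atTop (𝓝 0) := by
  have hr : Tendsto (fun n : ℕ => (n : ℝ)⁻¹) atTop (𝓝 0) := tendsto_inv_atTop_nhds_zero_nat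
  -- One power of 1/n has absorbed the factor n. The truncated exponent `B.card - 1` is harmless at
  -- the empty set, whose coefficient is zero.
  have key : ∀ B : Finset J, Tendsto (fun n : ℕ => blockVar μ B (remainder μ F) *
      ((n : ℝ)⁻¹ ^ (B.card - 1) * (1 - (n : ℝ)⁻¹) ^ (Bᶜ).card)) atTop (𝓝 0) := by
    intro B
    rcases lt_or_ge B.card 2 with hB | hB
    · have : blockVar μ B (remainder μ F) = 0 := by
        obtain hB | hB : B.card = 0 ∨ B.card = 1 := by omega
        · rw [Finset.card_eq_zero.1 hB, blockVar_empty (measurable_remainder hFm)]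
        · obtain ⟨k, rfl⟩ := Finset.card_eq_one.1 hB
          exact blockVar_singleton_remainder hFm (hF.integrable one_le_two) k
      simp [this]
    · have h1 := ((hr.pow (B.card - 1)).mul ((tendsto_const_nhds (x := (1 : ℝ))).sub hr |>.pow
        (Bᶜ).card)).const_mul (blockVar μ B (remainder μ F))
      rwa [zero_pow (by omega), zero_mul, mul_zero] at h1
  have h2 := tendsto_finsetSum (Finset.univ : Finset (Finset J)) fun B _ => key B
  rw [Finset.sum_const_zero] at h2
  refine h2.congr' ?_
  filter_upwards [eventually_gt_atTop 0] with n hn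
  rw [h.variance_vstat hn (measurable_remainder hFm) (memLp_remainder hFm hF), Finset.mul_sum]
  refine Finset.sum_congr rfl fun B _ => ?_
  have h0 : (n : ℝ) ≠ 0 := by positivity
  rcases Nat.eq_zero_or_pos B.card with hB | hB
  · rw [Finset.card_eq_zero.1 hB, blockVar_empty (measurable_remainder hFm)]
    simp
  · rw [← Nat.sub_add_cancel hB, pow_succ, Nat.add_sub_cancel]
    field_simp

end Sample

/-! ### Independent strata: variances and characteristic functions -/

section Strata

variable {ι : Type*} [Fintype ι] {Ω : Type*} [MeasurableSpace Ω] {P : Measure Ω}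
  [IsProbabilityMeasure P]

/-- Rows of an independent array are independent. -/
lemma iIndepFun_rows {κ E : Type*} [Countable κ] [Countable ι] [MeasurableSpace E]
    {X : ι → κ → Ω → E} (hX : ∀ i n, Measurable (X i n))
    (h : iIndepFun (fun p : ι × κ => X p.1 p.2) P) :
    iIndepFun (fun i ω (n : κ) => X i n ω) P := by
  have hprob : ∀ i n, IsProbabilityMeasure (P.map (X i n)) :=
    fun i n => Measure.isProbabilityMeasure_map (hX i n).aemeasurable
  rw [iIndepFun_iff_map_fun_eq_infinitePi_map fun i => measurable_pi_iff.2 (hX i)]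
  have h1 := h.map_fun_eq_infinitePi_map fun p : ι × κ => hX p.1 p.2
  -- The law of the whole array is an infinite product; currying it exhibits it as the product of
  -- the laws of the rows.
  have h2 := Measure.infinitePi_map_curry fun i n => P.map (X i n)
  rw [← h1, Measure.map_map (by fun_prop) (measurable_pi_iff.2 fun p : ι × κ => hX p.1 p.2)] at h2
  have h3 : ∀ i, P.map (fun ω n => X i n ω) = Measure.infinitePi fun n => P.map (X i n) := fun i =>
    (h.precomp (g := fun n => (i, n)) (Prod.mk_right_injective i)).map_fun_eq_infinitePi_map (hX i)
  simp_rw [h3, ← h2]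
  rfl

lemma variance_sum_const_mul {E : ι → Ω → ℝ} (θ : ι → ℝ) (hE : ∀ i, MemLp (E i) 2 P)
    (hind : Pairwise fun i j => IndepFun (E i) (E j) P) :
    variance (fun ω => ∑ i, θ i * E i ω) P = ∑ i, θ i ^ 2 * variance (E i) P := by
  have hL : ∀ i, MemLp (fun ω => θ i * E i ω) 2 P := fun i => (hE i).const_mul _
  have := IndepFun.variance_sum (μ := P) (X := fun i ω => θ i * E i ω) (s := Finset.univ)
    (fun i _ => hL i) fun i _ j _ hij => (hind hij).comp (φ := fun x => θ i * x)
      (ψ := fun x => θ j * x) (by fun_prop) (by fun_prop)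
  simp_rw [variance_const_mul] at this
  rw [← this]
  congr 1
  ext ω
  simp

lemma tendstoInMeasure_zero_of_variance {κ : Type*} {l : Filter κ} {D : κ → Ω → ℝ}
    (hD : ∀ n, MemLp (D n) 2 P) (h0 : ∀ᶠ n in l, ∫ ω, D n ω ∂P = 0)
    (hv : Tendsto (fun n => variance (D n) P) l (𝓝 0)) :
    TendstoInMeasure P D l 0 := by
  rw [tendstoInMeasure_iff_norm]
  intro ε hε
  have h1 : Tendsto (fun n => ENNReal.ofReal (variance (D n) P / ε ^ 2)) l (𝓝 0) := by
    have := ENNReal.tendsto_ofReal (hv.div_const (ε ^ 2))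
    simpa using this
  refine tendsto_of_tendsto_of_tendsto_of_le_of_le' tendsto_const_nhds h1
    (Eventually.of_forall fun _ => zero_le) ?_
  filter_upwards [h0] with n hn
  have := meas_ge_le_variance_div_sq (hD n) hε
  simpa [hn] using this

variable {J : ι → Type*} [∀ i, Fintype (J i)] [∀ i, DecidableEq (J i)] {T : ∀ i, J i → Type*}
  [∀ i j, MeasurableSpace (T i j)] {μ : ∀ i j, Measure (T i j)}
  [∀ i j, IsProbabilityMeasure (μ i j)] {Z : ∀ i, ℕ → Ω → ∀ j, T i j}
  {F : ∀ i, (∀ j, T i j) → ℝ}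

lemma iIndepFun_vstat {G : ∀ i, (∀ j, T i j) → ℝ}
    (hind : iIndepFun (fun i ω (n : ℕ) => Z i n ω) P) (hG : ∀ i, Measurable (G i)) (n : ι → ℕ) :
    iIndepFun (fun i => vstat (G i) (Z i) (n i)) P := by
  refine hind.comp (fun i z => vstat (G i) (fun l (z : ℕ → ∀ j, T i j) => z l) (n i) z) fun i => ?_
  refine (Finset.measurable_fun_sum _ fun m _ => (hG i).comp ?_).const_mul _
  exact measurable_pi_iff.2 fun j => (measurable_pi_apply j).comp (measurable_pi_apply _)

lemma iIndepFun_sum {G : ∀ i, (∀ j, T i j) → ℝ}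
    (hind : iIndepFun (fun i ω (n : ℕ) => Z i n ω) P) (hG : ∀ i, Measurable (G i))
    (c : ι → ℝ) (n : ι → ℕ) :
    iIndepFun (fun i ω => c i * ∑ l : Fin (n i), G i (Z i l ω)) P := by
  refine hind.comp (fun i z => c i * ∑ l : Fin (n i), G i (z l)) fun i => ?_
  exact (Finset.measurable_fun_sum _ fun m _ => (hG i).comp (measurable_pi_apply _)).const_mul _

/-- Convergence of the characteristic functions in the central limit theorem. -/
lemma tendsto_charFun_sum {J : Type*} [Fintype J] [DecidableEq J] {T : J → Type*}
    [∀ j, MeasurableSpace (T j)] {μ : ∀ j, Measure (T j)} [∀ j, IsProbabilityMeasure (μ j)]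
    {Z : ℕ → Ω → ∀ j, T j} (h : IsProductSample μ Z P) {G : (∀ j, T j) → ℝ} (hGm : Measurable G)
    (hG : MemLp G 2 (Measure.pi μ)) (h0 : ∫ x, G x ∂(Measure.pi μ) = 0) (t : ℝ) :
    Tendsto (fun n : ℕ => charFun (P.map fun ω => (√n)⁻¹ * ∑ l : Fin n, G (Z l ω)) t) atTop
      (𝓝 (charFun (gaussianReal 0 (variance G (Measure.pi μ)).toNNReal) t)) := by
  have hid : ∀ l, IdentDistrib (fun ω => G (Z l ω)) (fun ω => G (Z 0 ω)) P P := fun l =>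
    IdentDistrib.comp ⟨(h.measurable l).aemeasurable, (h.measurable 0).aemeasurable,
      (h.law l).trans (h.law 0).symm⟩ hGm
  have hmp : MeasurePreserving (Z 0) P (Measure.pi μ) := ⟨h.measurable 0, h.law 0⟩
  have hvar : variance (fun ω => G (Z 0 ω)) P = variance G (Measure.pi μ) :=
    hmp.variance_fun_comp hGm.aemeasurable
  have hmean : ∫ ω, G (Z 0 ω) ∂P = 0 := by
    rw [← h0]; exact h.integral_tuple (fun _ => 0) hGm
  have hclt := tendstoInDistribution_inv_sqrt_mul_sum_sub (P := P) (X := fun l ω => G (Z l ω))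
    (Y := id) (P' := gaussianReal 0 (variance G (Measure.pi μ)).toNNReal)
    (by rw [hvar]; exact HasLaw.id) (hG.comp_measurePreserving hmp)
    (h.indep.comp (fun _ => G) fun _ => hGm) hid
  have := (ProbabilityMeasure.tendsto_iff_tendsto_charFun.1 hclt.tendsto) t
  simp only [ProbabilityMeasure.coe_mk, Measure.map_id] at this
  refine this.congr fun n => ?_
  simp only [hmean, mul_zero, sub_zero]
  congr 3
  ext ω
  rw [Finset.sum_range]

/-- Lévy's continuity theorem is applied along sequences, which suffice because the filter is
countably generated. This covers the limit along admissible real N. -/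
lemma tendstoInDistribution_of_tendsto_charFun {κ : Type*} {l : Filter κ} [l.IsCountablyGenerated]
    {Y : κ → Ω → ℝ} (hY : ∀ n, AEMeasurable (Y n) P) {ρ : Measure ℝ} [IsProbabilityMeasure ρ]
    (h : ∀ t, Tendsto (fun n => charFun (P.map (Y n)) t) l (𝓝 (charFun ρ t))) :
    TendstoInDistribution Y l (id : ℝ → ℝ) (fun _ => P) ρ where
  forall_aemeasurable := hY
  aemeasurable_limit := aemeasurable_id
  tendsto := by
    refine tendsto_of_seq_tendsto fun x hx => ?_
    refine ProbabilityMeasure.tendsto_iff_tendsto_charFun.2 fun t => ?_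
    simp only [ProbabilityMeasure.coe_mk, Measure.map_id]
    exact (h t).comp hx

/-- By independence the characteristic function factors over strata, each evaluated at `a i * t`,
and the limiting Gaussian one factors in the same way. The strata may therefore grow at different
rates. -/
lemma tendsto_charFun_weighted_sum {κ : Type*} {L : Filter κ}
    (hZ : ∀ i, IsProductSample (μ i) (Z i) P)
    (hind : iIndepFun (fun i ω (n : ℕ) => Z i n ω) P) {G : ∀ i, (∀ j, T i j) → ℝ}
    (hGm : ∀ i, Measurable (G i)) (hG : ∀ i, MemLp (G i) 2 (Measure.pi (μ i)))
    (h0 : ∀ i, ∫ x, G i x ∂(Measure.pi (μ i)) = 0) (a : ι → ℝ) {n : ι → κ → ℕ}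
    (hn : ∀ i, Tendsto (n i) L atTop) (t : ℝ) :
    Tendsto (fun k => charFun (P.map fun ω =>
        ∑ i, a i * ((√(n i k : ℝ))⁻¹ * ∑ l : Fin (n i k), G i (Z i l ω))) t) L
      (𝓝 (charFun (gaussianReal 0
        (∑ i, a i ^ 2 * variance (G i) (Measure.pi (μ i))).toNNReal) t)) := by
  have hm : ∀ i k, Measurable fun ω => ∑ l : Fin (n i k), G i (Z i l ω) := fun i k =>
    Finset.measurable_fun_sum _ fun l _ => (hGm i).comp ((hZ i).measurable l)
  have h1 : ∀ k, charFun (P.map fun ω =>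
      ∑ i, a i * ((√(n i k : ℝ))⁻¹ * ∑ l : Fin (n i k), G i (Z i l ω))) t =
      ∏ i, charFun (P.map fun ω => (√(n i k : ℝ))⁻¹ * ∑ l : Fin (n i k), G i (Z i l ω))
        (a i * t) := by
    intro k
    have hi := iIndepFun_sum hind hGm (fun i => a i * (√(n i k : ℝ))⁻¹) fun i => n i k
    simp only [mul_assoc] at hi
    rw [hi.charFun_map_fun_sum_eq_prod fun i => (((hm i k).const_mul _).const_mul _).aemeasurable,
      Finset.prod_apply]
    exact Finset.prod_congr rfl fun i _ => charFun_map_mul_comp ((hm i k).const_mul _).aemeasurable _ _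
  simp_rw [h1]
  have h2 : charFun (gaussianReal 0
      (∑ i, a i ^ 2 * variance (G i) (Measure.pi (μ i))).toNNReal) t =
      ∏ i, charFun (gaussianReal 0 (variance (G i) (Measure.pi (μ i))).toNNReal) (a i * t) := by
    simp only [charFun_gaussianReal]
    rw [← Complex.exp_sum]
    congr 1
    rw [Real.coe_toNNReal _ (Finset.sum_nonneg fun i _ =>
      mul_nonneg (sq_nonneg _) (variance_nonneg _ _))]
    simp only [Real.coe_toNNReal _ (variance_nonneg _ _)]
    push_cast
    rw [Finset.sum_mul, Finset.sum_div]
    simp only [mul_zero, zero_mul, zero_sub, ← Finset.sum_neg_distrib]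
    exact Finset.sum_congr rfl fun i _ => by ring
  rw [h2]
  exact tendsto_finsetProd _ fun i _ =>
    (tendsto_charFun_sum (hZ i) (hGm i) (hG i) (h0 i) (a i * t)).comp (hn i)

end Strata

/-! ### Limits along admissible sample sizes and asymptotic normality -/

section Admissible

variable {I : ℕ} {α : Fin I → ℝ}

instance : (admTop α).IsCountablyGenerated := by
  unfold admTop; infer_instance

lemma eventually_mem_admissible : ∀ᶠ N in admTop α, N ∈ admissible α :=
  mem_inf_of_right (mem_principal_self _)

lemma sizes_eq {N : ℝ} (hN : N ∈ admissible α) (i : Fin I) : (sizes α N i : ℝ) = α i * N := by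
  obtain ⟨m, hm⟩ := hN.2 i
  simp [sizes, ← hm]

lemma sizes_pos (hα : ∀ i, 0 < α i) {N : ℝ} (hN : N ∈ admissible α) (i : Fin I) :
    0 < sizes α N i := by
  have := sizes_eq hN i
  have h : 0 < α i * N := mul_pos (hα i) hN.1
  rw [← this] at h
  exact_mod_cast h

lemma tendsto_sizes (hα : ∀ i, 0 < α i) (i : Fin I) :
    Tendsto (fun N => sizes α N i) (admTop α) atTop :=
  tendsto_nat_floor_atTop.comp
    ((tendsto_id.const_mul_atTop (hα i)).mono_left inf_le_left)

variable {Ω : Type*} [MeasurableSpace Ω] {P : Measure Ω} [IsProbabilityMeasure P]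
  {J : Fin I → Type*} [∀ i, Fintype (J i)] [∀ i, DecidableEq (J i)] {T : ∀ i, J i → Type*}
  [∀ i j, MeasurableSpace (T i j)] {μ : ∀ i j, Measure (T i j)}
  [∀ i j, IsProbabilityMeasure (μ i j)] {Z : ∀ i, ℕ → Ω → ∀ j, T i j}
  {F : ∀ i, (∀ j, T i j) → ℝ}

/-- Asymptotic normality of the weighted sum of the averages over permuted tuples. -/
lemma tendstoInDistribution_strata (hα : ∀ i, 0 < α i) (θ : Fin I → ℝ)
    (hZ : ∀ i, IsProductSample (μ i) (Z i) P)
    (hind : iIndepFun (fun i ω (n : ℕ) => Z i n ω) P)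
    (hFm : ∀ i, Measurable (F i)) (hF : ∀ i, MemLp (F i) 2 (Measure.pi (μ i))) :
    TendstoInDistribution
      (fun (N : ℝ) ω => √N * (∑ i, θ i * vstat (F i) (Z i) (sizes α N i) ω -
        ∑ i, θ i * ∫ x, F i x ∂(Measure.pi (μ i))))
      (admTop α) (id : ℝ → ℝ) (fun _ => P)
      (gaussianReal 0 (∑ i, θ i ^ 2 * sigmaProdSq (μ i) (F i) / α i).toNNReal) := by
  set g : ∀ i, (∀ j, T i j) → ℝ := fun i x => ∑ k, firstOrder (μ i) (F i) k x with hg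
  have hgm : ∀ i, Measurable (g i) := fun i =>
    Finset.measurable_fun_sum _ fun k _ => measurable_firstOrder (hFm i) k
  have hgL : ∀ i, MemLp (g i) 2 (Measure.pi (μ i)) := fun i =>
    memLp_finsetSum _ fun k _ => memLp_firstOrder (hFm i) (hF i) k
  have hg0 : ∀ i, ∫ x, g i x ∂(Measure.pi (μ i)) = 0 := fun i => by
    simp only [hg]
    rw [integral_finsetSum _ fun k _ =>
      (memLp_firstOrder (hFm i) (hF i) k).integrable one_le_two]
    simp [integral_firstOrder (hFm i) ((hF i).integrable one_le_two)]
  have hgv : ∀ i, variance (g i) (Measure.pi (μ i)) = sigmaProdSq (μ i) (F i) := fun i =>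
    variance_sum_firstOrder (hFm i) (hF i)
  -- Since N_i = α_i N, the weight √N θ_i / N_i equals (θ_i / √α_i) / √N_i.
  set a : Fin I → ℝ := fun i => θ i / √(α i) with ha
  set W : ℝ → Ω → ℝ := fun N ω =>
    ∑ i, a i * ((√(sizes α N i : ℝ))⁻¹ * ∑ l : Fin (sizes α N i), g i (Z i l ω)) with hW
  have hWm : ∀ N, Measurable (W N) := fun N =>
    Finset.measurable_fun_sum _ fun i _ => ((Finset.measurable_fun_sum _ fun (l : Fin _) _ =>
      (hgm i).comp ((hZ i).measurable l)).const_mul _).const_mul _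
  have hσ : ∑ i, θ i ^ 2 * sigmaProdSq (μ i) (F i) / α i =
      ∑ i, a i ^ 2 * variance (g i) (Measure.pi (μ i)) := by
    refine Finset.sum_congr rfl fun i _ => ?_
    rw [hgv, ha, div_pow, Real.sq_sqrt (hα i).le]
    ring
  have hWlim : TendstoInDistribution W (admTop α) (id : ℝ → ℝ) (fun _ => P)
      (gaussianReal 0 (∑ i, θ i ^ 2 * sigmaProdSq (μ i) (F i) / α i).toNNReal) := by
    refine tendstoInDistribution_of_tendsto_charFun (fun N => (hWm N).aemeasurable) fun t => ?_
    rw [hσ]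
    exact tendsto_charFun_weighted_sum hZ hind hgm hgL hg0 a (fun i => tendsto_sizes hα i) t
  -- Slutsky: the estimator may be replaced by its first-order part once the difference tends to
  -- zero in probability, which follows from Chebyshev's inequality.
  refine tendstoInDistribution_of_tendstoInMeasure_sub _ _ hWlim ?_ fun N => ?_
  swap
  · exact ((Finset.measurable_fun_sum _ fun i _ =>
      ((hZ i).measurable_vstat _ (hFm i)).const_mul _).sub_const _ |>.const_mul _).aemeasurable
  set D : ℝ → Ω → ℝ := fun N ω =>
    ∑ i, (√N * θ i) * vstat (remainder (μ i) (F i)) (Z i) (sizes α N i) ω with hD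
  have hrm := fun i => measurable_remainder (μ := μ i) (hFm i)
  have hrL := fun i => memLp_remainder (hFm i) (hF i)
  have hDL : ∀ N, MemLp (D N) 2 P := fun N =>
    memLp_finsetSum _ fun i _ => ((hZ i).memLp_vstat _ (hrL i)).const_mul _
  have hvD : ∀ N, variance (D N) P = ∑ i, (√N * θ i) ^ 2 *
      variance (vstat (remainder (μ i) (F i)) (Z i) (sizes α N i)) P := fun N =>
    variance_sum_const_mul _ (fun i => (hZ i).memLp_vstat _ (hrL i)) fun i j hij =>
      (iIndepFun_vstat hind hrm (sizes α N)).indepFun hij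
  have hD0 : ∀ᶠ N in admTop α, ∫ ω, D N ω ∂P = 0 := by
    filter_upwards [eventually_mem_admissible] with N hN
    simp only [hD]
    rw [integral_finsetSum _ fun i _ =>
      (((hZ i).memLp_vstat _ (hrL i)).integrable one_le_two).const_mul _]
    refine Finset.sum_eq_zero fun i _ => ?_
    rw [integral_const_mul, (hZ i).integral_vstat (sizes_pos hα hN i) (hrm i)
      ((hrL i).integrable one_le_two), integral_remainder (hFm i) ((hF i).integrable one_le_two),
      mul_zero]
  have hDv : Tendsto (fun N => variance (D N) P) (admTop α) (𝓝 0) := by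
    have h1 := tendsto_finsetSum (Finset.univ : Finset (Fin I)) fun i _ =>
      (((hZ i).tendsto_mul_variance_remainder (hFm i) (hF i)).comp
        (tendsto_sizes hα i)).const_mul (θ i ^ 2 / α i)
    simp only [mul_zero, Finset.sum_const_zero] at h1
    refine h1.congr' ?_
    filter_upwards [eventually_mem_admissible] with N hN
    rw [hvD]
    refine Finset.sum_congr rfl fun i _ => ?_
    rw [Function.comp_apply, sizes_eq hN, mul_pow, Real.sq_sqrt hN.1.le]
    have := (hα i).ne'
    field_simp
  have hDm := tendstoInMeasure_zero_of_variance hDL hD0 hDv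
  refine hDm.congr' ?_ .rfl
  filter_upwards [eventually_mem_admissible] with N hN
  refine ae_of_all _ fun ω => ?_
  simp only [hD, hW, Pi.sub_apply]
  rw [← Finset.sum_sub_distrib, Finset.mul_sum, ← Finset.sum_sub_distrib]
  refine Finset.sum_congr rfl fun i _ => ?_
  rw [vstat_remainder (sizes_pos hα hN i)]
  have h2 : a i * (√(sizes α N i : ℝ))⁻¹ = √N * θ i * (1 / (sizes α N i : ℝ)) := by
    have h3 := Real.sqrt_pos.2 (hα i)
    have h4 := Real.sqrt_pos.2 hN.1
    rw [sizes_eq hN, Real.sqrt_mul (hα i).le, ha]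
    have h5 := Real.sq_sqrt (hα i).le
    have h6 := Real.sq_sqrt hN.1.le
    have h7 := (hα i).ne'
    have h8 := hN.1.ne'
    field_simp
    rw [h5, h6]
  rw [← mul_assoc (a i), h2]
  ring

end Admissible

/-! ### Transfer between the original space and its block factorisation -/

section Glue

variable {K L : ℕ} {S : Fin K → Type*} [∀ k, MeasurableSpace (S k)]

/-- Split a point of `S_1 × ⋯ × S_K` into its blocks; inverse of `glue`. -/
def unglue (b : Fin K → Fin L) (x : ∀ k, S k) : ∀ j, BlockSpace S b j := fun _ k => x k

lemma measurable_unglue (b : Fin K → Fin L) : Measurable (unglue (S := S) b) :=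
  measurable_pi_iff.2 fun _ => measurable_pi_iff.2 fun _ => measurable_pi_apply _

lemma measurable_glue (b : Fin K → Fin L) : Measurable (glue (S := S) b) :=
  measurable_pi_iff.2 fun k => (measurable_pi_apply (⟨k, rfl⟩ : {k' : Fin K // b k' = b k})).comp
    (measurable_pi_apply (b k))

lemma unglue_glue (b : Fin K → Fin L) (x : ∀ j, BlockSpace S b j) : unglue b (glue b x) = x := by
  funext j ⟨k, hk⟩
  subst hk
  rfl

variable {b : Fin K → Fin L} {ν : ∀ j, Measure (BlockSpace S b j)}
  [∀ j, IsProbabilityMeasure (ν j)] {Ω : Type*} [MeasurableSpace Ω] {P : Measure Ω}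
  [IsProbabilityMeasure P] {X : ℕ → Ω → ∀ k, S k} {φ : (∀ k, S k) → ℝ}

lemma measurePreserving_glue : MeasurePreserving (glue b) (Measure.pi ν) (blockLaw b ν) :=
  ⟨measurable_glue b, rfl⟩

lemma isProductSample_unglue (hX : ∀ n, Measurable (X n)) (hind : iIndepFun X P)
    (hlaw : ∀ n, P.map (X n) = blockLaw b ν) :
    IsProductSample ν (fun n ω => unglue b (X n ω)) P where
  measurable n := (measurable_unglue b).comp (hX n)
  indep := hind.comp (fun _ => unglue b) fun _ => measurable_unglue b
  law n := by
    have h1 : P.map (fun ω => unglue b (X n ω)) = (P.map (X n)).map (unglue b) :=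
      (Measure.map_map (measurable_unglue b) (hX n)).symm
    rw [h1, hlaw, blockLaw, Measure.map_map (measurable_unglue b) (measurable_glue b)]
    have : unglue b ∘ glue b = (id : (∀ j, BlockSpace S b j) → _) := funext (unglue_glue b)
    rw [this, Measure.map_id]

lemma prodEst_eq (φ : (∀ k, S k) → ℝ) (X : ℕ → Ω → ∀ k, S k) (n : ℕ) :
    prodEst b φ X n = vstat (φ ∘ glue b) (fun n ω => unglue b (X n ω)) n := by
  ext ω
  simp only [prodEst, vstat, Fintype.card_fin]
  rfl

lemma stdEst_eq (φ : (∀ k, S k) → ℝ) (X : ℕ → Ω → ∀ k, S k) (n : ℕ) :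
    stdEst φ X n =
      fun ω => (1 / (n : ℝ)) * ∑ l : Fin n, (φ ∘ glue b) (unglue b (X l ω)) := rfl

lemma integral_blockLaw (hφ : Measurable φ) :
    ∫ x, φ x ∂(blockLaw b ν) = ∫ x, (φ ∘ glue b) x ∂(Measure.pi ν) :=
  integral_map (measurable_glue b).aemeasurable hφ.aestronglyMeasurable

lemma integral_sq_blockLaw (hφ : Measurable φ) :
    ∫ x, (φ x - ∫ z, φ z ∂(blockLaw b ν)) ^ 2 ∂(blockLaw b ν) =
      variance (φ ∘ glue b) (Measure.pi ν) := by
  rw [variance_eq_integral (hφ.comp (measurable_glue b)).aemeasurable, ← integral_blockLaw hφ]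
  exact integral_map (measurable_glue b).aemeasurable
    ((hφ.sub_const _).pow_const 2).aestronglyMeasurable

lemma variance_stdEst {n : ℕ} (hn : 0 < n) (hX : IsProductSample ν (fun n ω => unglue b (X n ω)) P)
    (hφ : Measurable φ) (hL : MemLp (φ ∘ glue b) 2 (Measure.pi ν)) :
    variance (stdEst φ X n) P = variance (φ ∘ glue b) (Measure.pi ν) / n := by
  have h0 : (n : ℝ) ≠ 0 := by positivity
  rw [stdEst_eq (b := b), variance_const_mul,
    hX.variance_sum_diag n (hφ.comp (measurable_glue b)) hL]
  field_simp

end Glue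

/-! ### Integrability and integrals under the mixture -/

section Mixture

variable {I K : ℕ} {S : Fin K → Type*} [∀ k, MeasurableSpace (S k)] {θ : Fin I → ℝ}
  {Kb : Fin I → ℕ} {b : ∀ i, Fin K → Fin (Kb i)}
  {ν : ∀ i j, Measure (BlockSpace S (b i) j)} [∀ i j, IsProbabilityMeasure (ν i j)]
  {φ : (∀ k, S k) → ℝ}

/-- Each component is dominated by θ_i⁻¹ times the mixture, so integrability passes to the
components; this needs every weight positive. -/
lemma memLp_comp_glue_of_mixture (hθ : ∀ i, 0 < θ i) {p : ENNReal}
    (hφ : MemLp φ p (mixture θ b ν)) (i : Fin I) :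
    MemLp (φ ∘ glue (b i)) p (Measure.pi (ν i)) := by
  have hc : ENNReal.ofReal (θ i) ≠ 0 := by simpa using hθ i
  have hle : blockLaw (b i) (ν i) ≤ (ENNReal.ofReal (θ i))⁻¹ • mixture θ b ν := by
    have h1 : ENNReal.ofReal (θ i) • blockLaw (b i) (ν i) ≤ mixture θ b ν :=
      Finset.single_le_sum (f := fun i => ENNReal.ofReal (θ i) • blockLaw (b i) (ν i))
        (fun _ _ => Measure.zero_le _) (Finset.mem_univ i)
    intro s
    have h2 := h1 s
    simp only [Measure.smul_apply, smul_eq_mul] at h2 ⊢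
    calc blockLaw (b i) (ν i) s
        = (ENNReal.ofReal (θ i))⁻¹ * (ENNReal.ofReal (θ i) * blockLaw (b i) (ν i) s) := by
          rw [← mul_assoc, ENNReal.inv_mul_cancel hc ENNReal.ofReal_ne_top, one_mul]
      _ ≤ _ := by gcongr
  exact (hφ.of_measure_le_smul (ENNReal.inv_ne_top.2 hc) hle).comp_measurePreserving
    measurePreserving_glue

lemma integral_mixture (hθ : ∀ i, 0 < θ i) (hφ : Measurable φ)
    (hi : Integrable φ (mixture θ b ν)) :
    ∫ x, φ x ∂(mixture θ b ν) =
      ∑ i, θ i * ∫ x, (φ ∘ glue (b i)) x ∂(Measure.pi (ν i)) := by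
  have hint : ∀ i, Integrable φ (ENNReal.ofReal (θ i) • blockLaw (b i) (ν i)) := fun i =>
    (integrable_finsetSum_measure.1 hi) i (Finset.mem_univ i)
  rw [mixture, integral_finsetSum_measure fun i _ => hint i]
  refine Finset.sum_congr rfl fun i _ => ?_
  rw [integral_smul_measure, ENNReal.toReal_ofReal (hθ i).le, integral_blockLaw hφ, smul_eq_mul]

end Mixture

end MixProd

end

/-! ### The main theorem -/

open MixProd in
theorem mainTheorem10 {I K : ℕ} {S : Fin K → Type*} [∀ k, MeasurableSpace (S k)]
    -- weights, partitions of the coordinates, and laws of the blocks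
    (θ : Fin I → ℝ) (hθ : ∀ i, 0 < θ i) (hθ_sum : ∑ i, θ i = 1)
    (Kb : Fin I → ℕ) (b : ∀ i, Fin K → Fin (Kb i)) (hb : ∀ i, Function.Surjective (b i))
    (ν : ∀ i j, Measure (MixProd.BlockSpace S (b i) j)) [∀ i j, IsProbabilityMeasure (ν i j)]
    -- independent sequences of i.i.d. samples from the components
    {Ω : Type*} [MeasurableSpace Ω] (P : Measure Ω) [IsProbabilityMeasure P]
    (X : Fin I → ℕ → Ω → ∀ k, S k) (hX : ∀ i n, Measurable (X i n))
    (hX_indep : iIndepFun (fun p : Fin I × ℕ => X p.1 p.2) P)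
    (hX_law : ∀ i n, P.map (X i n) = MixProd.blockLaw (b i) (ν i))
    (φ : (∀ k, S k) → ℝ) (hφ : Measurable φ) :
    -- unbiasedness
    (Integrable φ (MixProd.mixture θ b ν) →
      ∀ n : Fin I → ℕ, (∀ i, 0 < n i) →
        Integrable (MixProd.stratProdEst θ b φ X n) P ∧
        ∫ ω, MixProd.stratProdEst θ b φ X n ω ∂P = ∫ x, φ x ∂(MixProd.mixture θ b ν)) ∧
    (MemLp φ 2 (MixProd.mixture θ b ν) →
      -- the partial integrals in the variance formulas make sense
      (∀ i (A : Finset (Fin (Kb i))),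
        (∀ᵐ x ∂(Measure.pi (ν i)), Integrable
          (fun y => (φ ∘ MixProd.glue (b i)) (Function.updateFinset x A y))
          (MixProd.subLaw (ν i) A)) ∧
        MemLp (MixProd.partialInt (ν i) A (φ ∘ MixProd.glue (b i))) 2 (Measure.pi (ν i))) ∧
      (∀ α : Fin I → ℝ, (∀ i, 0 < α i) →
        -- strong consistency
        (∀ᵐ ω ∂P, Tendsto (fun N => MixProd.stratProdEst θ b φ X (MixProd.sizes α N) ω)
          (MixProd.admTop α) (𝓝 (∫ x, φ x ∂(MixProd.mixture θ b ν)))) ∧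
        -- asymptotic normality
        TendstoInDistribution
          (fun (N : ℝ) ω => √N * (MixProd.stratProdEst θ b φ X (MixProd.sizes α N) ω -
            ∫ x, φ x ∂(MixProd.mixture θ b ν)))
          (MixProd.admTop α) (id : ℝ → ℝ) (fun _ => P)
          (gaussianReal 0 (MixProd.asympVar θ α b ν φ).toNNReal) ∧
        -- finite-sample variance
        (∀ N ∈ MixProd.admissible α,
          (∀ i, MemLp (MixProd.prodEst (b i) φ (X i) (MixProd.sizes α N i)) 2 P) ∧
          MemLp (MixProd.stratProdEst θ b φ X (MixProd.sizes α N)) 2 P ∧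
          variance (MixProd.stratProdEst θ b φ X (MixProd.sizes α N)) P =
            ∑ i, θ i ^ 2 * variance (MixProd.prodEst (b i) φ (X i) (MixProd.sizes α N i)) P ∧
          variance (MixProd.stratProdEst θ b φ X (MixProd.sizes α N)) P =
            ∑ i, θ i ^ 2 * MixProd.prodVar (ν i) (φ ∘ MixProd.glue (b i)) (α i) N)) ∧
      -- proportional allocation: comparison with the stratified estimator
      (∀ N ∈ MixProd.admissible θ,
        (∀ i, MemLp (MixProd.stdEst φ (X i) (MixProd.sizes θ N i)) 2 P) ∧
        MemLp (MixProd.stratEst θ φ X (MixProd.sizes θ N)) 2 P ∧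
        variance (MixProd.stratProdEst θ b φ X (MixProd.sizes θ N)) P =
          ∑ i, θ i ^ 2 * variance (MixProd.prodEst (b i) φ (X i) (MixProd.sizes θ N i)) P ∧
        ∑ i, θ i ^ 2 * variance (MixProd.prodEst (b i) φ (X i) (MixProd.sizes θ N i)) P ≤
          ∑ i, θ i ^ 2 * variance (MixProd.stdEst φ (X i) (MixProd.sizes θ N i)) P ∧
        ∑ i, θ i ^ 2 * variance (MixProd.stdEst φ (X i) (MixProd.sizes θ N i)) P =
          variance (MixProd.stratEst θ φ X (MixProd.sizes θ N)) P) ∧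
      MixProd.asympVar θ θ b ν φ =
        ∑ i, θ i * MixProd.sigmaProdSq (ν i) (φ ∘ MixProd.glue (b i)) ∧
      ∑ i, θ i * MixProd.sigmaProdSq (ν i) (φ ∘ MixProd.glue (b i)) ≤
        ∑ i, θ i * ∫ x, (φ x - ∫ z, φ z ∂(MixProd.blockLaw (b i) (ν i))) ^ 2
          ∂(MixProd.blockLaw (b i) (ν i)) ∧
      Tendsto
        (fun N : ℝ => N * variance (MixProd.stratEst θ φ X (MixProd.sizes θ N)) P)
        (MixProd.admTop θ)
        (𝓝 (∑ i, θ i * ∫ x, (φ x - ∫ z, φ z ∂(MixProd.blockLaw (b i) (ν i))) ^ 2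
          ∂(MixProd.blockLaw (b i) (ν i))))) := by
  have hprod : ∀ i, IsProductSample (ν i) (fun n ω => unglue (b i) (X i n ω)) P := fun i =>
    isProductSample_unglue (hX i)
      (hX_indep.precomp (g := fun n : ℕ => (i, n)) (Prod.mk_right_injective i)) (hX_law i)
  have hrows : iIndepFun (fun i ω (n : ℕ) => unglue (b i) (X i n ω)) P :=
    (iIndepFun_rows hX hX_indep).comp (fun i x n => unglue (b i) (x n)) fun i =>
      measurable_pi_iff.2 fun n => (measurable_unglue (b i)).comp (measurable_pi_apply n)
  have hFm : ∀ i, Measurable (φ ∘ glue (b i)) := fun i => hφ.comp (measurable_glue (b i))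
  have hest : ∀ n : Fin I → ℕ, stratProdEst θ b φ X n = fun ω => ∑ i, θ i *
      vstat (φ ∘ glue (b i)) (fun n ω => unglue (b i) (X i n ω)) (n i) ω := by
    intro n
    ext ω
    simp only [stratProdEst, prodEst_eq]
  refine ⟨fun hi n hn => ?_, fun hL2 => ?_⟩
  · have hF : ∀ i, Integrable (φ ∘ glue (b i)) (Measure.pi (ν i)) := fun i =>
      memLp_one_iff_integrable.1 (memLp_comp_glue_of_mixture hθ (memLp_one_iff_integrable.2 hi) i)
    have hterm : ∀ i, Integrable (fun ω => θ i *
        vstat (φ ∘ glue (b i)) (fun n ω => unglue (b i) (X i n ω)) (n i) ω) P := fun i =>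
      ((hprod i).integrable_vstat (n i) (hF i)).const_mul _
    rw [hest]
    refine ⟨integrable_finsetSum _ fun i _ => hterm i, ?_⟩
    rw [integral_finsetSum _ fun i _ => hterm i, integral_mixture hθ hφ hi]
    refine Finset.sum_congr rfl fun i _ => ?_
    rw [integral_const_mul, (hprod i).integral_vstat (hn i) (hFm i) (hF i)]
  have hF : ∀ i, MemLp (φ ∘ glue (b i)) 2 (Measure.pi (ν i)) :=
    memLp_comp_glue_of_mixture hθ hL2
  have hmean : ∫ x, φ x ∂(mixture θ b ν) =
      ∑ i, θ i * ∫ x, (φ ∘ glue (b i)) x ∂(Measure.pi (ν i)) := by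
    have hfin : IsFiniteMeasure (mixture θ b ν) := by
      have : ∀ i, IsProbabilityMeasure (blockLaw (b i) (ν i)) := fun i =>
        Measure.isProbabilityMeasure_map (measurable_glue (b i)).aemeasurable
      have : ∀ i, IsFiniteMeasure (ENNReal.ofReal (θ i) • blockLaw (b i) (ν i)) := fun i =>
        Measure.smul_finite _ ENNReal.ofReal_ne_top
      unfold mixture
      infer_instance
    exact integral_mixture hθ hφ (hL2.integrable one_le_two)
  have hprodL : ∀ i n, MemLp (prodEst (b i) φ (X i) n) 2 P := fun i n => by
    rw [prodEst_eq]
    exact (hprod i).memLp_vstat n (hF i)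
  have hvar : ∀ n : Fin I → ℕ, variance (stratProdEst θ b φ X n) P =
      ∑ i, θ i ^ 2 * variance (prodEst (b i) φ (X i) (n i)) P := by
    intro n
    refine variance_sum_const_mul θ (fun i => hprodL i (n i)) fun i j hij => ?_
    simp only [prodEst_eq]
    exact (iIndepFun_vstat hrows hFm n).indepFun hij
  have hstdL : ∀ i n, MemLp (stdEst φ (X i) n) 2 P := fun i n => by
    rw [stdEst_eq (b := b i)]
    exact (memLp_finsetSum _ fun (l : Fin n) _ =>
      (hprod i).memLp_tuple (fun _ => (l : ℕ)) (hF i)).const_mul _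
  have hvarStd : ∀ n : Fin I → ℕ, variance (stratEst θ φ X n) P =
      ∑ i, θ i ^ 2 * variance (stdEst φ (X i) (n i)) P := by
    intro n
    refine variance_sum_const_mul θ (fun i => hstdL i (n i)) fun i j hij => ?_
    exact (iIndepFun_sum hrows hFm (fun i => 1 / (n i : ℝ)) n).indepFun hij
  refine ⟨fun i A => ⟨ae_integrable_updateFinset A ((hF i).integrable one_le_two),
    memLp_partialInt A (hFm i) (hF i)⟩, fun α hα => ⟨?_, ?_, fun N hN => ⟨fun i => hprodL i _, ?_,
    hvar _, ?_⟩⟩, fun N hN => ⟨fun i => hstdL i _, ?_, hvar _, ?_, (hvarStd _).symm⟩, ?_, ?_, ?_⟩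
  · have h1 := ae_all_iff.2 fun i => (hprod i).ae_tendsto_vstat (hFm i) (hF i)
    filter_upwards [h1] with ω hω
    simp only [hmean, hest]
    exact tendsto_finsetSum _ fun i _ => ((hω i).comp (tendsto_sizes hα i)).const_mul _
  · simp only [hmean, hest]
    exact tendstoInDistribution_strata hα θ hprod hrows hFm hF
  · exact memLp_finsetSum _ fun i _ => (hprodL i _).const_mul _
  · rw [hvar]
    refine Finset.sum_congr rfl fun i _ => ?_
    rw [prodEst_eq, (hprod i).variance_vstat_eq_prodVar (sizes_pos hα hN i) (sizes_eq hN i) (hFm i)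
      (hF i)]
  · exact memLp_finsetSum _ fun i _ => (hstdL i _).const_mul _
  · refine Finset.sum_le_sum fun i _ => mul_le_mul_of_nonneg_left ?_ (sq_nonneg _)
    have hpos := sizes_pos hθ hN i
    rw [variance_stdEst hpos (hprod i) hφ (hF i), prodEst_eq]
    exact (hprod i).variance_vstat_le hpos (hFm i) (hF i)
  · refine Finset.sum_congr rfl fun i _ => ?_
    have := (hθ i).ne'
    field_simp
  · refine Finset.sum_le_sum fun i _ => mul_le_mul_of_nonneg_left ?_ (hθ i).le
    rw [integral_sq_blockLaw hφ]
    exact sigmaProdSq_le_variance (hFm i) (hF i)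
  -- With N_i = θ_i N the factor N · θ_i² / N_i is exactly θ_i, so the function is constant on
  -- admissible N.
  · refine tendsto_const_nhds.congr' ?_
    filter_upwards [eventually_mem_admissible] with N hN
    rw [hvarStd, Finset.mul_sum]
    refine Finset.sum_congr rfl fun i _ => ?_
    rw [integral_sq_blockLaw hφ,
      variance_stdEst (sizes_pos hθ hN i) (hprod i) hφ (hF i), sizes_eq hN]
    have h1 := (hθ i).ne'
    have h2 := hN.1.ne'
    field_simp
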